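/- Let $\mathbb{K}$ be a field, $n\ge 0$, and let $Q$ be $\mathbb{R}^n$ or $\mathbb{Z}^n$ with the product order. A $Q$-persistence module is a functor from $Q$ to $\mathbb{K}$-vector spaces; it is finitely presentable if it is the cokernel of a map between finite direct sums of modules $\mathbb{K}_{\{p\ge q\}}$, $q\in Q$. Write $\underline{\dim}_V(q)=\dim V_q$. A stability condition is a map $Z$ from finitely presentable modules to $\mathbb{C}$ which is additive on short exact sequences and has positive real part on nonzero modules; the slope of $V\neq0$ is $\mu_Z(V)=\Im Z(V)/\Re Z(V)$. A nonzero finitely presentable $V$ is $Z$-semistable if $\mu_Z(W)\le\mu_Z(V)$ for all nonzero finitely presentable submodules $W\subset V$. A Harder–Narasimhan (HN) filtration of $V$ is a finite chain $0=V^0\subsetneq\dots\subsetneq V^\ell=V$ of finitely presentable submodules whose quotients $V^{i}/V^{i-1}$ are semistable with strictly decreasing slopes. If it exists and is unique, $\mathrm{HN}_Z^\theta(V)$ denotes the step $V^i$ with $\mu_Z(V^i/V^{i-1})\ge\theta>\mu_Z(V^{i+1}/V^i)$ (the first inequality being void for $i=0$ and the second for $i=\ell$). A grid function $G$ over $Q$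 is a product of strictly increasing functions $G_i\colon P_i\to\mathbb{R}$ (resp. $\mathbb{Z}$), where each $P_i\subset\mathbb{Z}$ is an interval, with $G_i(t)\to\pm\infty$ as $t\to\pm\infty$ when these limits make sense; it is finite if $P=\prod_i P_i$ is. Set $\lfloor q\rfloor_G=\max\{p\in P: G(p)\le q\}$, or $-\infty$ if there is no such $p$. A function on $Q$ is discretisable by $G$ if it is of the form $q\mapsto a(\lfloor q\rfloor_G)$ with $a\colon P\to\mathbb{R}$ and the convention $a(-\infty)=0$. An extension of $G$ is a grid function $G'$ such that $\mathrm{Im}\,G=\mathrm{Im}\,G'\cap c$ for a product $c$ of intervals. Let $\mathcal{Z}(Q)$ be the set of stability conditions for which there is a finite grid function $G$ with $$Z(V)=\int_Q (b+\sqrt{-1}\,a)\,\underline{\dim}_V+\sqrt{-1}\sum_c\lambda_c\,\delta_c(\underline{\dim}_V)\qquad\text{for all finitely presentable }V,$$ where $a,b\colon Q\to\mathbb{R}$ are discretisable by an extension of $G$, $a$ vanishes on the unbounded fibres of $\lfloor\cdot\rfloor_G$ (including that over $-\infty$), $b$ is strictly positive and integrable, $c$ runs over the faces of all dimensions of the bounded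 fibres $\prod_i[a_i,b_i)$ of $\lfloor\cdot\rfloor_G$, $\lambda_c\ge0$, and $\delta_c(f)$ is the average of $f$ over $c$ (with respect to the $\dim c$-dimensional measure). Integrals over $\mathbb{Z}^n$ are sums. For $x\in Q$ let $T_x^*V$ be the module $(T_x^*V)_q=V_{x+q}$, and for $\theta\in\mathbb{R}$ put $$s^\theta_{Z,V}(x,y)=\mathrm{rank}\big(\mathrm{HN}_Z^\theta(T_x^*V)_{0\le y-x}\big)\ \text{ if }x\le y,\qquad s^\theta_{Z,V}(x,y)=+\infty\ \text{ otherwise.}$$ For $\varepsilon\ge0$ (in $\mathbb{R}$, resp. $\mathbb{Z}$) let $\vec\varepsilon=(\varepsilon,\dots,\varepsilon)$. The interleaving distance $d_I(V,W)\in[0,\infty]$ is the infimum of the $\varepsilon\ge0$ such that there are maps $V\to T_{\vec\varepsilon}^*W$ and $W\to T_{\vec\varepsilon}^*V$ whose two compositions are the internal maps of $V$ and of $W$. The erosion distance $d_E(F,G)\in[0,\infty]$ is the infimum of the $\varepsilon\ge0$ such that $F(x-\vec\varepsilon,y+\vec\varepsilon)\le G(x,y)$ and $G(x-\vec\varepsilon,y+\vec\varepsilon)\le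 F(x,y)$ for all $x,y\in Q$. **Theorem.** Let $Z\in\mathcal{Z}(Q)$. Every finitely presentable $Q$-persistence module has exactly one HN filtration along $Z$, so that $s^\theta_{Z,V}$ is well defined for every finitely presentable $V$. For all finitely presentable $V,W$ and all $\theta\in\mathbb{R}$, the functions $s^\theta_{Z,V}$ and $s^\theta_{Z,W}$ are functors $Q^{\mathrm{op}}\times Q\to(\mathbb{Z}_+\cup\{\infty\})^{\mathrm{op}}$ (posets being seen as categories), and $$\sup_{\theta\in\mathbb{R}}d_E\big(s^\theta_{Z,V},s^\theta_{Z,W}\big)\le d_I(V,W).$$ -/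

import Mathlib

open CategoryTheory CategoryTheory.Limits MeasureTheory Filter
open scoped ENNReal NNReal

/- `Fin n → ℝ` and `Fin n → ℤ` are only used as posetal categories, never as product categories. -/
attribute [-instance] CategoryTheory.pi

noncomputable section

namespace HNPersistence

universe u

/-! ### Persistence modules, submodules and quotients -/

/-- Persistence modules over the poset `Q`, with coefficients in the field `K`. -/
abbrev Pers (K : Type u) [Field K] (Q : Type) [PartialOrder Q] := Q ⥤ ModuleCat.{u} K

section Modules

variable {K : Type u} [Field K] {Q : Type} [PartialOrder Q]

/-- The value at `p` of the spread module on `{p | q ≤ p}`: it is `K` if `q ≤ p`, and `0` if not. -/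
def upSpace (K : Type u) [Field K] (q p : Q) : Submodule K K where
  carrier := {c | ¬ q ≤ p → c = 0}
  add_mem' := by
    intro a b ha hb h
    rw [ha h, hb h, add_zero]
  zero_mem' := fun _ => rfl
  smul_mem' := by
    intro c x hx h
    rw [hx h, smul_zero]

theorem upSpace_mono (q : Q) {p p' : Q} (h : p ≤ p') : upSpace K q p ≤ upSpace K q p' :=
  fun _ hc hq => hc fun hqp => hq (hqp.trans h)

/-- The spread module `K_{q ≤ ·}`: it is `K` at all `p ≥ q`, with identities as maps, and `0`
elsewhere. -/
def upModule (K : Type u) [Field K] (q : Q) : Pers K Q where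
  obj p := ModuleCat.of K (upSpace K q p)
  map h := ModuleCat.ofHom (Submodule.inclusion (upSpace_mono q (leOfHom h)))
  map_id _ := by ext; rfl
  map_comp _ _ := by ext; rfl

/-- Free and finitely generated: a finite direct sum of modules `K_{q ≤ ·}`. -/
def IsFreeFG (V : Pers K Q) : Prop :=
  ∃ (m : ℕ) (g : Fin m → Q), Nonempty (V ≅ ∐ fun j => upModule K (g j))

/-- Finitely presentable: the cokernel of a map between free finitely generated modules. -/
def IsFP (V : Pers K Q) : Prop :=
  ∃ (F₁ F₀ : Pers K Q) (φ : F₁ ⟶ F₀), IsFreeFG F₁ ∧ IsFreeFG F₀ ∧ Nonempty (V ≅ cokernel φ)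

/-- The dimension vector. -/
def dimVec (V : Pers K Q) (q : Q) : ℕ := Module.finrank K (V.obj q)

/-- Submodules of a persistence module. -/
@[ext]
structure PersSub (V : Pers K Q) where
  space : ∀ q, Submodule K (V.obj q)
  map_le : ∀ {p q : Q} (h : p ⟶ q), space p ≤ (space q).comap (V.map h).hom

namespace PersSub

variable {V : Pers K Q}

instance : PartialOrder (PersSub V) :=
  PartialOrder.lift PersSub.space fun _ _ h => PersSub.ext h

instance : Bot (PersSub V) := ⟨⟨fun _ => ⊥, fun _ => bot_le⟩⟩

instance : Top (PersSub V) := ⟨⟨fun _ => ⊤, fun _ _ _ => trivial⟩⟩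

/-- A submodule, seen as a persistence module. -/
def toPers (A : PersSub V) : Pers K Q where
  obj q := ModuleCat.of K (A.space q)
  map h := ModuleCat.ofHom ((V.map h).hom.restrict (A.map_le h))
  map_id q := by
    ext x
    change (V.map (𝟙 q)).hom x.1 = x.1
    simp
  map_comp f g := by
    ext x
    change (V.map (f ≫ g)).hom x.1 = (V.map g).hom ((V.map f).hom x.1)
    simp

theorem quot_map_le (A B : PersSub V) {p q : Q} (h : p ⟶ q) :
    (A.space p).comap (B.space p).subtype ≤
      ((A.space q).comap (B.space q).subtype).comap ((V.map h).hom.restrict (B.map_le h)) :=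
  fun _ hx => A.map_le h hx

/-- The quotient `B / A` of two submodules `A ≤ B` of `V`. -/
def quot (A B : PersSub V) : Pers K Q where
  obj q := ModuleCat.of K (B.space q ⧸ (A.space q).comap (B.space q).subtype)
  map h := ModuleCat.ofHom
    (Submodule.mapQ _ _ ((V.map h).hom.restrict (B.map_le h)) (quot_map_le A B h))
  map_id q := by
    ext x
    change Submodule.Quotient.mk (((V.map (𝟙 q)).hom.restrict (B.map_le (𝟙 q))) x) =
      Submodule.Quotient.mk x
    congr 1
    apply Subtype.ext
    change (V.map (𝟙 q)).hom x.1 = x.1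
    simp
  map_comp f g := by
    ext x
    change Submodule.Quotient.mk (((V.map (f ≫ g)).hom.restrict (B.map_le (f ≫ g))) x) =
      Submodule.Quotient.mk (((V.map g).hom.restrict (B.map_le g))
        (((V.map f).hom.restrict (B.map_le f)) x))
    congr 1
    apply Subtype.ext
    change (V.map (f ≫ g)).hom x.1 = (V.map g).hom ((V.map f).hom x.1)
    simp

end PersSub

/-! ### Stability conditions and Harder-Narasimhan filtrations -/

/-- A stability condition on the finitely presentable modules: a function on objects that is
additive on short exact sequences (that is, a homomorphism from the Grothendieck group to `ℂ`)
and has positive real part on nonzero objects. Only its values on finitely presentable modules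
are ever used. -/
structure StabilityCondition (K : Type u) [Field K] (Q : Type) [PartialOrder Q] where
  val : Pers K Q → ℂ
  additive : ∀ S : ShortComplex (Pers K Q), S.ShortExact → IsFP S.X₁ → IsFP S.X₂ → IsFP S.X₃ →
    val S.X₂ = val S.X₁ + val S.X₃
  re_pos : ∀ V : Pers K Q, IsFP V → ¬ IsZero V → 0 < (val V).re

/-- The slope of a (nonzero) module. -/
def slope (Z : StabilityCondition K Q) (V : Pers K Q) : ℝ := (Z.val V).im / (Z.val V).re

/-- Semistable objects of the category of finitely presentable modules. -/
def IsSemistable (Z : StabilityCondition K Q) (V : Pers K Q) : Prop :=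
  IsFP V ∧ ¬ IsZero V ∧
    ∀ W : PersSub V, IsFP W.toPers → W ≠ ⊥ → slope Z W.toPers ≤ slope Z V

/-- The successive quotients of a strictly increasing chain of submodules. -/
def gr {V : Pers K Q} (F : LTSeries (PersSub V)) (j : Fin F.length) : Pers K Q :=
  PersSub.quot (F j.castSucc) (F j.succ)

/-- `F` is a Harder-Narasimhan filtration of `V` along `Z`, in the category of finitely
presentable modules. -/
structure IsHNFiltration (Z : StabilityCondition K Q) (V : Pers K Q)
    (F : LTSeries (PersSub V)) : Prop where
  head_eq : F.head = ⊥
  last_eq : F.last = ⊤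
  isFP : ∀ i, IsFP (F i).toPers
  semistable : ∀ j, IsSemistable Z (gr F j)
  slope_anti : StrictAnti fun j => slope Z (gr F j)

/-- `W` is the step `V^i` of the HN filtration of `V` along `Z` such that
`slope (V^i / V^{i-1}) ≥ θ > slope (V^{i+1} / V^i)`, where the first inequality is void for the
first step of the chain and the second one is void for the last step. -/
def IsHNPart (Z : StabilityCondition K Q) (θ : ℝ) (V : Pers K Q) (W : PersSub V) : Prop :=
  ∃ F : LTSeries (PersSub V), IsHNFiltration Z V F ∧ ∃ i : Fin (F.length + 1), F i = W ∧
    (∀ j : Fin F.length, j.succ = i → θ ≤ slope Z (gr F j)) ∧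
    (∀ j : Fin F.length, j.castSucc = i → slope Z (gr F j) < θ)

open Classical in
/-- The part of slope at least `θ` of the HN filtration of `V` along `Z`. -/
def hnPart (Z : StabilityCondition K Q) (θ : ℝ) (V : Pers K Q) : PersSub V :=
  if h : ∃ W, IsHNPart Z θ V W then h.choose else ⊥

end Modules

/-! ### Shifts, HN filtered rank invariants, interleavings and erosions -/

section Shifts

variable {K : Type u} [Field K] {Q : Type} [AddCommGroup Q] [PartialOrder Q]
  [IsOrderedAddMonoid Q]

/-- The shift functor on objects: `shift x V` has the value `V_{x + q}` at `q`. -/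
def shift (x : Q) (V : Pers K Q) : Pers K Q :=
  (show Monotone fun q : Q => x + q from fun _ _ h => add_le_add_right h x).functor ⋙ V

open Classical in
/-- The HN filtered rank invariant of `V` along `Z`. -/
def hnRank (Z : StabilityCondition K Q) (V : Pers K Q) (θ : ℝ) (x y : Q) : ℕ∞ :=
  if h : x ≤ y then
    Cardinal.toENat (LinearMap.rank
      ((hnPart Z θ (shift x V)).toPers.map (homOfLE (sub_nonneg.mpr h))).hom)
  else ⊤

/-- There is an interleaving with shift vector `e` between `V` and `W`: maps `f : V ⟶ T_e^* W`
and `g : W ⟶ T_e^* V` whose two compositions are the internal maps of `V` and of `W`. -/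
def Interleaved (e : Q) (V W : Pers K Q) : Prop :=
  ∃ (f : V ⟶ shift e W) (g : W ⟶ shift e V) (h : ∀ q : Q, q ≤ e + (e + q)),
    (∀ q, f.app q ≫ g.app (e + q) = V.map (homOfLE (h q))) ∧
    (∀ q, g.app q ≫ f.app (e + q) = W.map (homOfLE (h q)))

/-- There is an erosion with shift vector `e` between `F` and `G`. -/
def Eroded (e : Q) (F G : Q → Q → ℕ∞) : Prop :=
  ∀ a b, F (a - e) (b + e) ≤ G a b ∧ G (a - e) (b + e) ≤ F a b

/-- The function `s` on `Q × Q` is (the object part of) a functor `Qᵒᵖ × Q ⥤ (ℕ ∪ {∞})ᵒᵖ` between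
posets seen as categories. -/
def IsFunctorial (s : Q → Q → ℕ∞) : Prop :=
  ∃ F : Qᵒᵖ × Q ⥤ ℕ∞ᵒᵖ, ∀ x y, F.obj (Opposite.op x, y) = Opposite.op (s x y)

end Shifts

section Distances

variable {K : Type u} [Field K] {n : ℕ} {T : Type} [AddCommGroup T] [LinearOrder T]
  [IsOrderedAddMonoid T] [ENorm T]

/-- The interleaving distance of modules over `T ^ n`, where `T` is `ℝ` or `ℤ`. For `ε ≥ 0` the
extended norm of `ε` is `ε` itself, as an element of `[0, ∞]`. -/
def interleavingDist (V W : Pers K (Fin n → T)) : ℝ≥0∞ :=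
  ⨅ (ε : T) (_ : 0 ≤ ε) (_ : Interleaved (fun _ => ε) V W), ‖ε‖ₑ

/-- The erosion distance, where `T` is `ℝ` or `ℤ`. -/
def erosionDist (F G : (Fin n → T) → (Fin n → T) → ℕ∞) : ℝ≥0∞ :=
  ⨅ (ε : T) (_ : 0 ≤ ε) (_ : Eroded (fun _ => ε) F G), ‖ε‖ₑ

end Distances

/-! ### Grid functions and the family of stability conditions -/

/-- A grid function over `T ^ n`: a product of strictly increasing functions from intervals of
`ℤ` to `T`, with `G_i(t) → ±∞` as `t → ±∞` whenever this limit makes sense. -/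
structure GridFunction (n : ℕ) (T : Type) [LinearOrder T] where
  dom : Fin n → Set ℤ
  ordConnected : ∀ i, (dom i).OrdConnected
  coord : ∀ i, dom i → T
  strictMono : ∀ i, StrictMono (coord i)
  tendsto_top : ∀ i, ¬ BddAbove (dom i) → Tendsto (coord i) atTop atTop
  tendsto_bot : ∀ i, ¬ BddBelow (dom i) → Tendsto (coord i) atBot atBot

namespace GridFunction

variable {n : ℕ} {T : Type} [LinearOrder T]

/-- The cube of `ℤ ^ n` on which the grid function is defined. -/
abbrev Pt (G : GridFunction n T) : Type := ∀ i, G.dom i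

/-- The grid function as a map to `T ^ n`. -/
def toFun (G : GridFunction n T) (p : G.Pt) : Fin n → T := fun i => G.coord i (p i)

/-- The fibre over `p` of the floor function of `G`. -/
def cell (G : GridFunction n T) (p : G.Pt) : Set (Fin n → T) :=
  {q | IsGreatest {p' : G.Pt | G.toFun p' ≤ q} p}

/-- The fibre over `-∞` of the floor function of `G`. -/
def cellBot (G : GridFunction n T) : Set (Fin n → T) := {q | ∀ p : G.Pt, ¬ G.toFun p ≤ q}

/-- `f` is discretisable by `G`: it is `q ↦ a(⌊q⌋)` for some function `a` on the domain of `G`,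
with the convention `a(-∞) = 0`. -/
def Discretises (G : GridFunction n T) (f : (Fin n → T) → ℝ) : Prop :=
  ∃ a : G.Pt → ℝ, (∀ p, ∀ q ∈ G.cell p, f q = a p) ∧ ∀ q ∈ G.cellBot, f q = 0

/-- `G'` is an extension of `G`: the image of `G` is the intersection of the image of `G'` with
a cube (a product of intervals) of `T ^ n`. -/
def IsExtension (G' G : GridFunction n T) : Prop :=
  ∃ I : Fin n → Set T, (∀ i, (I i).OrdConnected) ∧
    Set.range G.toFun = Set.range G'.toFun ∩ Set.univ.pi I

end GridFunction

/-- Boundedness of a subset of `T ^ n`. -/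
def IsBoundedBox {n : ℕ} {T : Type} [LinearOrder T] (c : Set (Fin n → T)) : Prop :=
  BddBelow c ∧ BddAbove c

/-- The three faces of an interval `[a, b)`: the whole interval, `{a}` and `{b}`. -/
inductive FaceKind where
  | full
  | lower
  | upper

/-- The natural measure on a face of `[a, b)`, if `μ` is that of the line: the restriction of
`μ` to the whole interval, or the unit mass at an endpoint. -/
def FaceKind.measure {T : Type} [LinearOrder T] [MeasurableSpace T] (μ : Measure T) (a b : T) :
    FaceKind → Measure T
  | .full => μ.restrict (Set.Ico a b)
  | .lower => Measure.dirac a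
  | .upper => Measure.dirac b

/-- A face of a bounded cube delimited by `G`: the cube is the fibre over `base`, and equals the
product of the intervals `[G_i(base_i), corner_i)`; the face is the product of the faces
`kind i` of these intervals. -/
structure GridFace {n : ℕ} {T : Type} [LinearOrder T] (G : GridFunction n T) where
  base : G.Pt
  corner : Fin n → T
  cell_eq : G.cell base = Set.univ.pi fun i => Set.Ico (G.toFun base i) (corner i)
  kind : Fin n → FaceKind

/-- The linear form `δ_c` of a face `c`: the average of `f` over `c`, with respect to the
measure of the dimension of `c`. -/
def GridFace.avg {n : ℕ} {T : Type} [LinearOrder T] [MeasurableSpace T] {G : GridFunction n T}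
    (μ : Measure T) (c : GridFace G) (f : (Fin n → T) → ℝ) : ℝ :=
  ⨍ q, f q ∂(Measure.pi fun i => (c.kind i).measure μ (G.toFun c.base i) (c.corner i))

/-- The stability conditions of the family `𝒵(G)`:
`[V] ↦ ∫ (b + √-1 a) dim V + √-1 ∑_c λ_c δ_c(dim V)`, where `a` and `b` are discretisable by an
extension of `G`, `a` is null on the unbounded fibres of the floor function of `G`, `b` is
positive and integrable, `c` runs over faces of bounded cubes of `G`, and `λ_c ≥ 0`. -/
def MemFamilyOf {K : Type u} [Field K] {n : ℕ} {T : Type} [LinearOrder T] [MeasurableSpace T]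
    (μ : Measure T) (G : GridFunction n T) (Z : StabilityCondition K (Fin n → T)) : Prop :=
  ∃ (G' : GridFunction n T) (a b : (Fin n → T) → ℝ) (l : GridFace G →₀ ℝ≥0),
    G'.IsExtension G ∧ G'.Discretises a ∧ G'.Discretises b ∧
    (∀ p, ¬ IsBoundedBox (G.cell p) → ∀ q ∈ G.cell p, a q = 0) ∧
    (¬ IsBoundedBox G.cellBot → ∀ q ∈ G.cellBot, a q = 0) ∧
    (∀ q, 0 < b q) ∧ Integrable b (Measure.pi fun _ => μ) ∧
    ∀ V : Pers K (Fin n → T), IsFP V →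
      Z.val V =
        (∫ q, ((b q : ℂ) + Complex.I * (a q : ℂ)) * (dimVec V q : ℂ) ∂(Measure.pi fun _ => μ)) +
          Complex.I * ((l.sum fun c t => (t : ℝ) * c.avg μ fun q => (dimVec V q : ℝ) : ℝ) : ℂ)

/-- The family `𝒵(T ^ n)`: the union of `𝒵(G)` over the finite grid functions `G`. Here `μ` is
the Lebesgue measure for `T = ℝ`, and the counting measure for `T = ℤ`. -/
def MemFamily {K : Type u} [Field K] {n : ℕ} {T : Type} [LinearOrder T] [MeasurableSpace T]
    (μ : Measure T) (Z : StabilityCondition K (Fin n → T)) : Prop :=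
  ∃ G : GridFunction n T, Finite G.Pt ∧ MemFamilyOf μ G Z

end HNPersistence

end

/-!
The argument has three parts.

*Discretisation.* A module over `T ^ n` is finitely presentable if and only if it is constant on
the cells of a finite grid `S ^ n`, pointwise finite-dimensional, and zero below the grid
(`isFP_iff_exists_isGridded`). Hence finitely presentable submodules are closed under sums,
intersections, images and preimages. They may live on arbitrarily fine grids, but for a stability
condition `Z` of the family each module `V` has one finite grid such that every finitely
presentable `W ⊆ V` can be replaced with a submodule on this grid without decreasing
`level Z θ W = Im Z(W) - θ Re Z(W)` (`MemFamily.exists_isDiscretisable`). The grid is chosen to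
discretise `V` and such that the densities are constant on its bounded cells. One pulls `W` back
along a map `T ^ n → T ^ n` which sends a gap `[x, y)` between consecutive grid points, in one
coordinate, to one of its points `s`. By Fubini's theorem the average over `s` of the integral
against the densities is its value for `W`. The average over a face of the grid can only increase
if the face meets the gap in its first point, because the dimension of `W` increases along each
cell, and this is where the coefficients of the faces have to be nonnegative. So the level does not
decrease for some `s` (`exists_squash_le`). Beyond the last grid point the imaginary density
vanishes, so the level is monotone in the dimension vector there, and the first or a very large
value of `s` will do. Doing this for all gaps and all coordinates leaves a submodule on the grid.

*Harder-Narasimhan filtrations.* `Z` takes finitely many values on submodules on a given grid.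
Starting from zero, one repeatedly takes the largest submodule on the grid of maximal slope
relative to the previous step; the steps are Harder-Narasimhan by discretisation
(`exists_isHNFiltration`). For uniqueness, the part of slope at least `θ` of any filtration is the
largest maximiser of `level Z θ` among finitely presentable submodules
(`IsHNPart.isLargestMaximiser`).

*Stability.* This description shows that morphisms preserve the parts of slope at least `θ`
(`IsLargestMaximiser.map_le`). If an internal map of a module factors through another module, via
morphisms of the shifted modules, the ranks on these parts can thus be compared
(`hnRank_le_hnRank`). With internal maps this is functoriality, and with the maps of an
interleaving it is stability.
-/

noncomputable section

namespace HNPersistence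

universe u

/-! ### Exactness of persistence modules is pointwise -/

section Exactness

variable {K : Type u} [Field K] {Q : Type} [PartialOrder Q]

theorem shortComplex_exact_iff_apply (S : ShortComplex (Pers K Q)) :
    S.Exact ↔ ∀ q, ∀ y, (S.g.app q).hom y = 0 → ∃ x, (S.f.app q).hom x = y := by
  have key : ∀ q, (S.map ((evaluation Q (ModuleCat.{u} K)).obj q)).Exact ↔
      ∀ y, (S.g.app q).hom y = 0 → ∃ x, (S.f.app q).hom x = y := fun q =>
    ShortComplex.moduleCat_exact_iff _
  constructor
  · intro h q
    exact (key q).1 (h.map _)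
  · intro h
    rw [ShortComplex.exact_iff_isZero_homology]
    refine (Functor.isZero_iff _).2 fun q => ?_
    have := (ShortComplex.exact_iff_isZero_homology _).1 ((key q).2 (h q))
    exact this.of_iso (S.mapHomologyIso ((evaluation Q (ModuleCat.{u} K)).obj q)).symm

theorem apply_naturality {V W : Pers K Q} (f : V ⟶ W) {p q : Q} (h : p ⟶ q) (x : V.obj p) :
    (f.app q).hom ((V.map h).hom x) = (W.map h).hom ((f.app p).hom x) := by
  exact congrArg (fun t => t.hom x) (f.naturality h)

theorem map_apply_map (V : Pers K Q) {p q r : Q} (f : p ⟶ q) (g : q ⟶ r) (k : p ⟶ r)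
    (x : V.obj p) : (V.map g).hom ((V.map f).hom x) = (V.map k).hom x := by
  rw [Subsingleton.elim k (f ≫ g), V.map_comp]; rfl

theorem epi_of_surjective {V W : Pers K Q} (f : V ⟶ W)
    (h : ∀ q, Function.Surjective (f.app q).hom) : Epi f := by
  have : ∀ q, Epi (f.app q) := fun q => (ModuleCat.epi_iff_surjective _).2 (h q)
  exact NatTrans.epi_of_epi_app f

theorem surjective_of_epi {V W : Pers K Q} (f : V ⟶ W) [Epi f] (q : Q) :
    Function.Surjective (f.app q).hom :=
  (ModuleCat.epi_iff_surjective _).1 inferInstance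

theorem mono_of_injective {V W : Pers K Q} (f : V ⟶ W)
    (h : ∀ q, Function.Injective (f.app q).hom) : Mono f := by
  have : ∀ q, Mono (f.app q) := fun q => (ModuleCat.mono_iff_injective _).2 (h q)
  exact NatTrans.mono_of_mono_app f

theorem injective_of_mono {V W : Pers K Q} (f : V ⟶ W) [Mono f] (q : Q) :
    Function.Injective (f.app q).hom :=
  (ModuleCat.mono_iff_injective _).1 inferInstance

theorem isZero_iff_subsingleton (V : Pers K Q) : IsZero V ↔ ∀ q, Subsingleton (V.obj q) := by
  rw [Functor.isZero_iff]
  exact forall_congr' fun q =>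
    ⟨fun h => ModuleCat.subsingleton_of_isZero h, fun h => ModuleCat.isZero_of_subsingleton _⟩

end Exactness

/-! ### Finitely presentable modules are those constant on the cells of a finite grid -/

section Gridded

variable {K : Type u} [Field K] {n : ℕ} {T : Type} [LinearOrder T]

/-- Two points lie in the same cell of the grid `S ^ n`: no coordinate in `S` separates them. -/
def SameCell (S : Finset T) (p q : Fin n → T) : Prop := ∀ i, ∀ s ∈ S, s ≤ p i ↔ s ≤ q i

/-- The module `V` is discretised by the finite grid `S ^ n`: it is pointwise finite-dimensional,
zero at the points below no grid point, and constant on the cells of the grid. The same set `S`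
is used for all coordinates, which is harmless since grids may be refined. -/
structure IsGridded (S : Finset T) (V : Pers K (Fin n → T)) : Prop where
  finite : ∀ q, Module.Finite K (V.obj q)
  subsingleton : ∀ q, (∃ i, ∀ s ∈ S, ¬ s ≤ q i) → Subsingleton (V.obj q)
  bijective : ∀ (p q : Fin n → T) (h : p ⟶ q), SameCell S p q →
    Function.Bijective (V.map h).hom

theorem SameCell.mono {S S' : Finset T} (h : S ⊆ S') {p q : Fin n → T} (hpq : SameCell S' p q) :
    SameCell S p q := fun i s hs => hpq i s (h hs)

theorem SameCell.symm {S : Finset T} {p q : Fin n → T} (h : SameCell S p q) : SameCell S q p :=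
  fun i s hs => (h i s hs).symm

theorem SameCell.trans {S : Finset T} {p q r : Fin n → T} (h : SameCell S p q)
    (h' : SameCell S q r) : SameCell S p r :=
  fun i s hs => (h i s hs).trans (h' i s hs)

theorem SameCell.inf {S : Finset T} {p q : Fin n → T} (h : SameCell S p q) :
    SameCell S (p ⊓ q) q := fun i s hs => by
  have := h i s hs
  simp only [Pi.inf_apply, le_inf_iff]
  tauto

theorem IsGridded.mono {S S' : Finset T} (h : S ⊆ S') {V : Pers K (Fin n → T)}
    (hV : IsGridded S V) : IsGridded S' V where
  finite := hV.finite
  subsingleton q := fun ⟨i, hi⟩ => hV.subsingleton q ⟨i, fun s hs => hi s (h hs)⟩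
  bijective p q f hpq := hV.bijective p q f (hpq.mono h)

theorem IsGridded.of_iso {S : Finset T} {V W : Pers K (Fin n → T)} (e : V ≅ W)
    (hV : IsGridded S V) : IsGridded S W := by
  let E : ∀ q, V.obj q ≃ₗ[K] W.obj q := fun q => (e.app q).toLinearEquiv
  refine ⟨fun q => ?_, fun q hq => ?_, fun p q h hpq => ?_⟩
  · have := hV.finite q
    exact Module.Finite.equiv (E q)
  · have := hV.subsingleton q hq
    exact (E q).symm.toEquiv.subsingleton
  · have hcomp : ⇑(W.map h).hom = E q ∘ (V.map h).hom ∘ (E p).symm := by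
      funext x
      have := apply_naturality e.hom h ((E p).symm x)
      refine Eq.trans ?_ this.symm
      congr 1
      exact ((E p).apply_symm_apply x).symm
    rw [hcomp]
    exact (E q).bijective.comp ((hV.bijective p q h hpq).comp (E p).symm.bijective)

/-- A cokernel of gridded modules is gridded. -/
theorem IsGridded.cokernel {S : Finset T} {V W : Pers K (Fin n → T)} (φ : V ⟶ W)
    (hV : IsGridded S V) (hW : IsGridded S W) : IsGridded S (cokernel φ) := by
  have hs := surjective_of_epi (cokernel.π φ)
  have hex := (shortComplex_exact_iff_apply _).1 (ShortComplex.exact_cokernel φ)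
  dsimp only at hex
  have hz : ∀ q x, ((cokernel.π φ).app q).hom ((φ.app q).hom x) = 0 := by
    intro q x
    exact congrArg (fun t => (t.app q).hom x) (cokernel.condition φ)
  refine ⟨fun q => ?_, fun q hq => ?_, fun p q h hpq => ⟨?_, ?_⟩⟩
  · have := hW.finite q
    exact Module.Finite.of_surjective _ (hs q)
  · have := hW.subsingleton q hq
    exact (hs q).subsingleton
  · rw [injective_iff_map_eq_zero]
    intro c hc
    obtain ⟨x, rfl⟩ := hs p c
    rw [← apply_naturality] at hc
    obtain ⟨y, hy⟩ := hex q _ hc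
    obtain ⟨y', rfl⟩ := (hV.bijective p q h hpq).2 y
    rw [apply_naturality] at hy
    rw [← (hW.bijective p q h hpq).1 hy]
    exact hz p y'
  · intro c
    obtain ⟨x, rfl⟩ := hs q c
    obtain ⟨x', rfl⟩ := (hW.bijective p q h hpq).2 x
    exact ⟨((cokernel.π φ).app p).hom x', (apply_naturality _ _ _).symm⟩

/-- A kernel of gridded modules is gridded. -/
theorem IsGridded.kernel {S : Finset T} {V W : Pers K (Fin n → T)} (φ : V ⟶ W)
    (hV : IsGridded S V) (hW : IsGridded S W) : IsGridded S (kernel φ) := by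
  have hi := injective_of_mono (kernel.ι φ)
  have hex := (shortComplex_exact_iff_apply _).1 (ShortComplex.exact_kernel φ)
  dsimp only at hex
  have hz : ∀ q x, (φ.app q).hom (((kernel.ι φ).app q).hom x) = 0 := by
    intro q x
    exact congrArg (fun t => (t.app q).hom x) (kernel.condition φ)
  refine ⟨fun q => ?_, fun q hq => ?_, fun p q h hpq => ⟨?_, ?_⟩⟩
  · have := hV.finite q
    exact Module.Finite.of_injective _ (hi q)
  · have := hV.subsingleton q hq
    exact (hi q).subsingleton
  · intro x y hxy
    refine hi p ((hV.bijective p q h hpq).1 ?_)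
    rw [← apply_naturality, ← apply_naturality, hxy]
  · intro x
    obtain ⟨y, hy⟩ := (hV.bijective p q h hpq).2 (((kernel.ι φ).app q).hom x)
    have h0 : (φ.app p).hom y = 0 := by
      refine (hW.bijective p q h hpq).1 ?_
      rw [← apply_naturality, hy, hz, map_zero]
    obtain ⟨x', rfl⟩ := hex p y h0
    refine ⟨x', hi q ?_⟩
    rw [apply_naturality, hy]

theorem upModule_isGridded (S : Finset T) (g : Fin n → T) (hg : ∀ i, g i ∈ S) :
    IsGridded S (upModule K g) := by
  refine ⟨fun q => inferInstanceAs (Module.Finite K (upSpace K g q)), fun q ⟨i, hi⟩ => ?_,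
    fun p q h hpq => ⟨?_, ?_⟩⟩
  · refine ⟨fun x y => ?_⟩
    have hq : ¬ g ≤ q := fun h => hi (g i) (hg i) (h i)
    exact Subtype.ext ((x.2 hq).trans (y.2 hq).symm)
  · intro x y hxy
    exact Subtype.ext (congrArg (fun t : upSpace K g q => t.1) hxy)
  · intro y
    refine ⟨⟨y.1, fun hp => y.2 fun hq => hp fun i => ?_⟩, rfl⟩
    exact (hpq i _ (hg i)).2 (hq i)

/-- A finite direct sum of gridded modules is gridded. -/
theorem IsGridded.coprod {S : Finset T} {m : ℕ} (V : Fin m → Pers K (Fin n → T))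
    (hV : ∀ j, IsGridded S (V j)) : IsGridded S (∐ V) := by
  have : HasFiniteBiproducts (Pers K (Fin n → T)) := HasFiniteBiproducts.of_hasFiniteProducts
  refine IsGridded.of_iso (biproduct.isoCoproduct V) ?_
  have htot : ∀ q (x : (⨁ V).obj q),
      ∑ j, ((biproduct.ι V j).app q).hom (((biproduct.π V j).app q).hom x) = x := by
    intro q x
    have h : ((∑ j, biproduct.π V j ≫ biproduct.ι V j).app q).hom x = x :=
      congrArg (fun t => (t.app q).hom x) (biproduct.total (f := V))
    rw [NatTrans.app_sum, ModuleCat.hom_sum, LinearMap.sum_apply] at h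
    exact h
  have hinj : ∀ q (x y : (⨁ V).obj q), (∀ j, ((biproduct.π V j).app q).hom x =
      ((biproduct.π V j).app q).hom y) → x = y := by
    intro q x y h
    rw [← htot q x, ← htot q y]
    simp only [h]
  refine ⟨fun q => ?_, fun q hq => ⟨fun x y => hinj q x y fun j => ?_⟩,
    fun p q h hpq => ⟨fun x y hxy => hinj p x y fun j => ?_, fun y => ?_⟩⟩
  · have := fun j => (hV j).finite q
    refine Module.Finite.of_injective
      (LinearMap.pi fun j => ((biproduct.π V j).app q).hom) fun x y hxy =>
        hinj q x y fun j => congrFun hxy j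
  · have := (hV j).subsingleton q hq
    exact Subsingleton.elim _ _
  · refine ((hV j).bijective p q h hpq).1 ?_
    rw [← apply_naturality, ← apply_naturality, hxy]
  · choose x hx using fun j => ((hV j).bijective p q h hpq).2 (((biproduct.π V j).app q).hom y)
    refine ⟨∑ j, ((biproduct.ι V j).app p).hom (x j), ?_⟩
    rw [map_sum]
    conv_rhs => rw [← htot q y]
    refine Finset.sum_congr rfl fun j _ => ?_
    rw [← apply_naturality, hx]

theorem IsFreeFG.exists_isGridded {V : Pers K (Fin n → T)} (h : IsFreeFG V) :
    ∃ S, IsGridded S V := by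
  obtain ⟨m, g, ⟨e⟩⟩ := h
  classical
  refine ⟨Finset.univ.image fun x : Fin m × Fin n => g x.1 x.2, IsGridded.of_iso e.symm
    (IsGridded.coprod _ fun j => upModule_isGridded _ _ fun i => ?_)⟩
  exact Finset.mem_image.2 ⟨(j, i), Finset.mem_univ _, rfl⟩

/-- The map `K_{g ≤ ·} ⟶ V` which corresponds to `v ∈ V_g`. -/
def upDesc (V : Pers K (Fin n → T)) (g : Fin n → T) (v : V.obj g) : upModule K g ⟶ V := by
  classical
  exact
  { app := fun q => ModuleCat.ofHom (if h : g ≤ q then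
      (LinearMap.toSpanSingleton K (V.obj q) ((V.map (homOfLE h)).hom v)).comp
        (upSpace K g q).subtype else 0)
    naturality := by
      intro p q h
      ext x
      obtain ⟨c, hc⟩ := x
      by_cases hp : g ≤ p
      · have hq : g ≤ q := hp.trans (leOfHom h)
        rw [dif_pos hp, dif_pos hq]
        change c • (V.map (homOfLE hq)).hom v = (V.map h).hom (c • (V.map (homOfLE hp)).hom v)
        rw [map_smul, map_apply_map V (homOfLE hp) h (homOfLE hq)]
      · have h0 : (⟨c, hc⟩ : upSpace K g p) = 0 := Subtype.ext (hc hp)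
        have h1 : ((upModule K g).map h ≫ ModuleCat.ofHom (if h : g ≤ q then
      (LinearMap.toSpanSingleton K (V.obj q) ((V.map (homOfLE h)).hom v)).comp
        (upSpace K g q).subtype else 0)).hom (0 : upSpace K g p) = 0 := map_zero _
        rw [h0]
        exact h1.trans (map_zero _).symm }

theorem exists_upDesc_apply_eq (V : Pers K (Fin n → T)) (g q : Fin n → T) (h : g ⟶ q)
    (v : V.obj g) : ∃ x, ((upDesc V g v).app q).hom x = (V.map h).hom v := by
  refine ⟨(⟨1, fun hq => absurd (leOfHom h) hq⟩ : upSpace K g q), ?_⟩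
  have h' : g ≤ q := leOfHom h
  simp only [upDesc]
  rw [dif_pos h']
  exact one_smul K _

/-- The largest grid point below `q`, if there is one. -/
theorem exists_floor (S : Finset T) (q : Fin n → T) (hq : ∀ i, ∃ s ∈ S, s ≤ q i) :
    ∃ p : Fin n → S, (fun i => (p i : T)) ≤ q ∧ SameCell S (fun i => (p i : T)) q := by
  classical
  have : ∀ i, ∃ p : S, (p : T) ≤ q i ∧ ∀ s ∈ S, s ≤ q i → s ≤ p := by
    intro i
    obtain ⟨s, hs, hsq⟩ := hq i
    have hne : (S.filter (· ≤ q i)).Nonempty := ⟨s, Finset.mem_filter.2 ⟨hs, hsq⟩⟩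
    have := Finset.mem_filter.1 (Finset.max'_mem _ hne)
    exact ⟨⟨_, this.1⟩, this.2, fun t ht htq => Finset.le_max' _ _ (Finset.mem_filter.2 ⟨ht, htq⟩)⟩
  choose p hp hp' using this
  exact ⟨p, hp, fun i s hs => ⟨fun h => h.trans (hp i), hp' i s hs⟩⟩

/-- A gridded module is a quotient of a finite direct sum of modules generated at grid points. -/
theorem IsGridded.exists_epi {S : Finset T} {V : Pers K (Fin n → T)} (hV : IsGridded S V) :
    ∃ (F : Pers K (Fin n → T)) (f : F ⟶ V), IsFreeFG F ∧ Epi f := by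
  classical
  have := hV.finite
  let B := fun q => Module.finBasis K (V.obj q)
  let I := Σ p : Fin n → S, Fin (Module.finrank K (V.obj fun i => (p i : T)))
  let e : Fin (Fintype.card I) ≃ I := (Fintype.equivFin I).symm
  let g : Fin (Fintype.card I) → (Fin n → T) := fun j i => ((e j).1 i : T)
  let f : (∐ fun j => upModule K (g j)) ⟶ V :=
    Limits.Sigma.desc fun j => upDesc V (g j) (B (g j) (e j).2)
  refine ⟨_, f, ⟨_, g, ⟨Iso.refl _⟩⟩, epi_of_surjective f fun q v => ?_⟩
  by_cases hq : ∃ i, ∀ s ∈ S, ¬ s ≤ q i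
  · have := hV.subsingleton q hq
    exact ⟨0, Subsingleton.elim _ _⟩
  · push Not at hq
    obtain ⟨p, hpq, hc⟩ := exists_floor S q hq
    obtain ⟨v, rfl⟩ := (hV.bijective _ q (homOfLE hpq) hc).2 v
    suffices h : ∀ v, v ∈ (LinearMap.range (f.app q).hom).comap (V.map (homOfLE hpq)).hom from
      h v
    intro v
    suffices h : (⊤ : Submodule K (V.obj fun i => (p i : T))) ≤
        (LinearMap.range (f.app q).hom).comap (V.map (homOfLE hpq)).hom from h trivial
    rw [← (B _).span_eq, Submodule.span_le]
    rintro _ ⟨k, rfl⟩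
    obtain ⟨j, hj⟩ := e.surjective ⟨p, k⟩
    have key : ∃ x, ((upDesc V (g j) (B (g j) (e j).2)).app q).hom x =
        (V.map (homOfLE hpq)).hom (B _ k) := by
      have : ∀ (z : I) (hz : z = ⟨p, k⟩), ∃ x,
          ((upDesc V (fun i => (z.1 i : T)) (B (fun i => (z.1 i : T)) z.2)).app q).hom x =
        (V.map (homOfLE hpq)).hom (B _ k) := by
        rintro z rfl
        exact exists_upDesc_apply_eq _ _ _ _ _
      exact this _ hj
    obtain ⟨x, hx⟩ := key
    refine ⟨((Limits.Sigma.ι (fun j => upModule K (g j)) j).app q).hom x, ?_⟩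
    rw [← hx]
    have := congrArg (fun t => (t.app q).hom x)
      (Limits.Sigma.ι_desc (fun j => upDesc V (g j) (B (g j) (e j).2)) j)
    exact this

/-- A module is finitely presentable if and only if it is discretised by a finite grid. -/
theorem isFP_iff_exists_isGridded {V : Pers K (Fin n → T)} :
    IsFP V ↔ ∃ S, IsGridded S V := by
  classical
  constructor
  · rintro ⟨F₁, F₀, φ, h₁, h₀, ⟨e⟩⟩
    obtain ⟨S₁, h₁⟩ := h₁.exists_isGridded
    obtain ⟨S₀, h₀⟩ := h₀.exists_isGridded
    exact ⟨S₁ ∪ S₀, IsGridded.of_iso e.symm (IsGridded.cokernel φ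
      (h₁.mono Finset.subset_union_left) (h₀.mono Finset.subset_union_right))⟩
  · rintro ⟨S, hV⟩
    obtain ⟨F₀, f, hF₀, hf⟩ := hV.exists_epi
    obtain ⟨S₀, h₀⟩ := hF₀.exists_isGridded
    have hk : IsGridded (S ∪ S₀) (Limits.kernel f) := IsGridded.kernel f
      (h₀.mono Finset.subset_union_right) (hV.mono Finset.subset_union_left)
    obtain ⟨F₁, k, hF₁, hk⟩ := hk.exists_epi
    refine ⟨F₁, F₀, k ≫ kernel.ι f, hF₁, hF₀, ⟨?_⟩⟩
    exact (Abelian.epiIsCokernelOfKernel _ (kernelIsKernel f)).coconePointUniqueUpToIso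
      (cokernelIsCokernel (kernel.ι f)) ≪≫ (cokernelEpiComp k (kernel.ι f)).symm

end Gridded

/-! ### The lattice of submodules of a persistence module -/

section Lattice

variable {K : Type u} [Field K] {Q : Type} [PartialOrder Q] {V W : Pers K Q}

namespace PersSub

instance : Lattice (PersSub V) where
  sup A B := ⟨fun q => A.space q ⊔ B.space q, fun h => sup_le
    ((A.map_le h).trans (Submodule.comap_mono le_sup_left))
    ((B.map_le h).trans (Submodule.comap_mono le_sup_right))⟩
  inf A B := ⟨fun q => A.space q ⊓ B.space q, fun h => inf_le_inf (A.map_le h) (B.map_le h)⟩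
  le_sup_left _ _ _ := le_sup_left
  le_sup_right _ _ _ := le_sup_right
  sup_le _ _ _ h h' q := sup_le (h q) (h' q)
  inf_le_left _ _ _ := inf_le_left
  inf_le_right _ _ _ := inf_le_right
  le_inf _ _ _ h h' q := le_inf (h q) (h' q)

instance : BoundedOrder (PersSub V) where
  bot_le _ _ := bot_le
  le_top _ _ := le_top

@[simp] theorem sup_space (A B : PersSub V) (q : Q) :
    (A ⊔ B).space q = A.space q ⊔ B.space q := rfl

@[simp] theorem inf_space (A B : PersSub V) (q : Q) :
    (A ⊓ B).space q = A.space q ⊓ B.space q := rfl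

/-- The image of a submodule under a morphism. -/
def map (φ : V ⟶ W) (A : PersSub V) : PersSub W where
  space q := (A.space q).map (φ.app q).hom
  map_le := by
    rintro p q h _ ⟨x, hx, rfl⟩
    exact ⟨(V.map h).hom x, A.map_le h hx, apply_naturality φ h x⟩

/-- The preimage of a submodule under a morphism. -/
def comap (φ : V ⟶ W) (B : PersSub W) : PersSub V where
  space q := (B.space q).comap (φ.app q).hom
  map_le := by
    intro p q h x hx
    change (φ.app q).hom _ ∈ B.space q
    rw [apply_naturality]
    exact B.map_le h hx

/-- The preimage in `B` of a submodule of `B / A`, as a submodule of the ambient module. -/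
def quotLift (A B : PersSub V) (X : PersSub (quot A B)) : PersSub V where
  space q := ((X.space q).comap ((A.space q).comap (B.space q).subtype).mkQ).map
    (B.space q).subtype
  map_le := by
    rintro p q h _ ⟨x, hx, rfl⟩
    exact ⟨⟨(V.map h).hom x.1, B.map_le h x.2⟩, X.map_le h hx, rfl⟩

/-- The image in `B / A` of a submodule of the ambient module. -/
def quotSub (A B W : PersSub V) : PersSub (quot A B) where
  space q := ((W.space q).comap (B.space q).subtype).map
    ((A.space q).comap (B.space q).subtype).mkQ
  map_le := by
    rintro p q h _ ⟨x, hx, rfl⟩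
    exact ⟨⟨(V.map h).hom x.1, B.map_le h x.2⟩, W.map_le h hx, rfl⟩

theorem quotLift_le (A B : PersSub V) (X : PersSub (quot A B)) : quotLift A B X ≤ B := by
  rintro q _ ⟨x, -, rfl⟩
  exact x.2

theorem le_quotLift {A B : PersSub V} (h : A ≤ B) (X : PersSub (quot A B)) :
    A ≤ quotLift A B X := by
  intro q x hx
  refine ⟨⟨x, h q hx⟩, ?_, rfl⟩
  have : ((A.space q).comap (B.space q).subtype).mkQ ⟨x, h q hx⟩ = 0 :=
    (Submodule.Quotient.mk_eq_zero _).2 hx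
  change ((A.space q).comap (B.space q).subtype).mkQ ⟨x, h q hx⟩ ∈ X.space q
  rw [this]
  exact zero_mem _

theorem quotLift_quotSub {A B W : PersSub V} (hAW : A ≤ W) (hWB : W ≤ B) :
    quotLift A B (quotSub A B W) = W := by
  ext q x
  constructor
  · rintro ⟨y, ⟨z, hz, hzy⟩, rfl⟩
    have h : z - y ∈ (A.space q).comap (B.space q).subtype :=
      (Submodule.Quotient.eq _).1 hzy
    have h' : (y : V.obj q) = z - (z - y) := by abel
    change (y : V.obj q) ∈ W.space q
    rw [h']
    exact sub_mem hz (hAW q h)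
  · intro hx
    exact ⟨⟨x, hWB q hx⟩, ⟨⟨x, hWB q hx⟩, hx, rfl⟩, rfl⟩

end PersSub

theorem finrank_comap_mkQ {M : Type*} [AddCommGroup M] [Module K M] [Module.Finite K M]
    (N : Submodule K M) (X : Submodule K (M ⧸ N)) :
    Module.finrank K (X.comap N.mkQ) = Module.finrank K X + Module.finrank K N := by
  have hN : N ≤ X.comap N.mkQ := fun x hx => by
    rw [Submodule.mem_comap, Submodule.mkQ_apply, (Submodule.Quotient.mk_eq_zero N).2 hx]
    exact zero_mem _
  have h := LinearMap.finrank_range_add_finrank_ker (N.mkQ.domRestrict (X.comap N.mkQ))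
  have h1 : LinearMap.range (N.mkQ.domRestrict (X.comap N.mkQ)) = X := by
    rw [LinearMap.range_domRestrict, Submodule.map_comap_eq_of_surjective N.mkQ_surjective]
  have h2 : LinearMap.ker (N.mkQ.domRestrict (X.comap N.mkQ)) =
      N.comap (X.comap N.mkQ).subtype := by
    ext x
    exact Submodule.Quotient.mk_eq_zero N
  rw [h1, h2, (Submodule.comapSubtypeEquivOfLe hN).finrank_eq] at h
  exact h.symm

theorem finrank_quot_add {A B : PersSub V} (h : A ≤ B) (q : Q) [Module.Finite K (V.obj q)] :
    dimVec (PersSub.quot A B) q + Module.finrank K (A.space q) =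
      Module.finrank K (B.space q) := by
  have h1 := Submodule.finrank_quotient_add_finrank ((A.space q).comap (B.space q).subtype)
  rw [(Submodule.comapSubtypeEquivOfLe (h q)).finrank_eq] at h1
  exact h1

theorem finrank_quotLift {A B : PersSub V} (h : A ≤ B) (X : PersSub (PersSub.quot A B)) (q : Q)
    [Module.Finite K (V.obj q)] :
    Module.finrank K ((PersSub.quotLift A B X).space q) =
      Module.finrank K (X.space q) + Module.finrank K (A.space q) := by
  have h1 := finrank_comap_mkQ ((A.space q).comap (B.space q).subtype) (X.space q)
  rw [(Submodule.comapSubtypeEquivOfLe (h q)).finrank_eq] at h1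
  refine Eq.trans ?_ h1
  exact (Submodule.equivMapOfInjective _ (Submodule.injective_subtype _) _).finrank_eq.symm

/-- The short exact sequence `0 ⟶ A ⟶ B ⟶ B / A ⟶ 0`. -/
def quotSequence {A B : PersSub V} (h : A ≤ B) : ShortComplex (Pers K Q) where
  X₁ := A.toPers
  X₂ := B.toPers
  X₃ := PersSub.quot A B
  f := { app := fun q => ModuleCat.ofHom (Submodule.inclusion (h q))
         naturality := fun _ _ _ => rfl }
  g := { app := fun q => ModuleCat.ofHom ((A.space q).comap (B.space q).subtype).mkQ
         naturality := fun _ _ _ => rfl }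
  zero := by
    ext q x
    exact (Submodule.Quotient.mk_eq_zero _).2 x.2

theorem quotSequence_shortExact {A B : PersSub V} (h : A ≤ B) :
    (quotSequence h).ShortExact where
  exact := by
    rw [shortComplex_exact_iff_apply]
    intro q y hy
    have hy' : y.1 ∈ A.space q :=
      (Submodule.Quotient.mk_eq_zero ((A.space q).comap (B.space q).subtype)).1 hy
    exact ⟨⟨y.1, hy'⟩, rfl⟩
  mono_f := mono_of_injective _ fun q => Submodule.inclusion_injective (h q)
  epi_g := epi_of_surjective _ fun q =>
    ((A.space q).comap (B.space q).subtype).mkQ_surjective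

theorem not_isZero_quot {A B : PersSub V} (h : A < B) : ¬ IsZero (PersSub.quot A B) := by
  intro h0
  refine h.not_ge fun q x hx => ?_
  have : Subsingleton (B.space q ⧸ (A.space q).comap (B.space q).subtype) :=
    (isZero_iff_subsingleton _).1 h0 q
  exact (Submodule.Quotient.mk_eq_zero ((A.space q).comap (B.space q).subtype)).1
    (Subsingleton.elim (Submodule.Quotient.mk ⟨x, hx⟩) 0)

end Lattice

/-! ### Finitely presentable submodules -/

section SubGridded

variable {K : Type u} [Field K] {n : ℕ} {T : Type} [LinearOrder T]
  {V W : Pers K (Fin n → T)} {S S' : Finset T}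

/-- A submodule is constant on the cells of the grid `S ^ n`. -/
def PersSub.IsGridded (S : Finset T) (A : PersSub V) : Prop :=
  ∀ (p q : Fin n → T) (h : p ⟶ q), SameCell S p q →
    A.space q ≤ (A.space p).map (V.map h).hom

namespace PersSub

variable {A B : PersSub V}

theorem IsGridded.mono (h : S ⊆ S') (hA : A.IsGridded S) : A.IsGridded S' :=
  fun p q f hpq => hA p q f (hpq.mono h)

theorem isGridded_toPers_iff (hV : HNPersistence.IsGridded S V) :
    HNPersistence.IsGridded S A.toPers ↔ A.IsGridded S := by
  constructor
  · intro h p q f hpq x hx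
    obtain ⟨y, hy⟩ := (h.bijective p q f hpq).2 ⟨x, hx⟩
    exact ⟨y.1, y.2, congrArg (fun t : A.space q => t.1) hy⟩
  · intro h
    refine ⟨fun q => ?_, fun q hq => ?_, fun p q f hpq => ⟨fun x y hxy => ?_, fun x => ?_⟩⟩
    · have := hV.finite q
      exact inferInstanceAs (Module.Finite K (A.space q))
    · have := hV.subsingleton q hq
      exact inferInstanceAs (Subsingleton (A.space q))
    · exact Subtype.ext ((hV.bijective p q f hpq).1
        (congrArg (fun t : A.space q => t.1) hxy))
    · obtain ⟨y, hy, hyx⟩ := h p q f hpq x.2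
      exact ⟨⟨y, hy⟩, Subtype.ext hyx⟩

theorem isFP_toPers_iff (hV : IsFP V) :
    IsFP A.toPers ↔ ∃ S, HNPersistence.IsGridded S V ∧ A.IsGridded S := by
  classical
  constructor
  · intro h
    obtain ⟨S₁, h₁⟩ := isFP_iff_exists_isGridded.1 hV
    obtain ⟨S₂, h₂⟩ := isFP_iff_exists_isGridded.1 h
    have h₁' := h₁.mono (Finset.subset_union_left (s₂ := S₂))
    exact ⟨S₁ ∪ S₂, h₁', (isGridded_toPers_iff h₁').1 (h₂.mono Finset.subset_union_right)⟩
  · rintro ⟨S, h₁, h₂⟩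
    exact isFP_iff_exists_isGridded.2 ⟨S, (isGridded_toPers_iff h₁).2 h₂⟩

/-- Two finitely presentable submodules are constant on the cells of a common grid. -/
theorem exists_common_grid (hV : IsFP V) (hA : IsFP A.toPers) (hB : IsFP B.toPers) :
    ∃ S, HNPersistence.IsGridded S V ∧ A.IsGridded S ∧ B.IsGridded S := by
  classical
  obtain ⟨S₁, hV, h₁⟩ := (isFP_toPers_iff hV).1 hA
  obtain ⟨S₂, hV', h₂⟩ := (isFP_toPers_iff (isFP_iff_exists_isGridded.2 ⟨_, hV⟩)).1 hB
  exact ⟨S₁ ∪ S₂, hV.mono Finset.subset_union_left, h₁.mono Finset.subset_union_left,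
    h₂.mono Finset.subset_union_right⟩

theorem IsGridded.inf (hV : HNPersistence.IsGridded S V) (hA : A.IsGridded S)
    (hB : B.IsGridded S) : (A ⊓ B).IsGridded S := by
  rintro p q f hpq x ⟨hxA, hxB⟩
  obtain ⟨a, ha, rfl⟩ := hA p q f hpq hxA
  obtain ⟨b, hb, hab⟩ := hB p q f hpq hxB
  obtain rfl := (hV.bijective p q f hpq).1 hab
  exact ⟨b, ⟨ha, hb⟩, rfl⟩

theorem IsGridded.sup (hA : A.IsGridded S) (hB : B.IsGridded S) : (A ⊔ B).IsGridded S := by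
  intro p q f hpq
  rw [sup_space, sup_space, Submodule.map_sup]
  exact sup_le_sup (hA p q f hpq) (hB p q f hpq)

theorem IsGridded.map (φ : V ⟶ W) (hA : A.IsGridded S) : (A.map φ).IsGridded S := by
  rintro p q f hpq _ ⟨x, hx, rfl⟩
  obtain ⟨y, hy, rfl⟩ := hA p q f hpq hx
  exact ⟨_, ⟨y, hy, rfl⟩, (apply_naturality φ f y).symm⟩

theorem IsGridded.comap (φ : V ⟶ W) {B : PersSub W} (hV : HNPersistence.IsGridded S V)
    (hW : HNPersistence.IsGridded S W) (hB : B.IsGridded S) : (B.comap φ).IsGridded S := by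
  intro p q f hpq x hx
  obtain ⟨y, rfl⟩ := (hV.bijective p q f hpq).2 x
  change (φ.app q).hom _ ∈ B.space q at hx
  rw [apply_naturality] at hx
  obtain ⟨b, hb, hby⟩ := hB p q f hpq hx
  obtain rfl := (hW.bijective p q f hpq).1 hby
  exact ⟨y, hb, rfl⟩

theorem IsGridded.quot (hV : HNPersistence.IsGridded S V) (hA : A.IsGridded S)
    (hB : B.IsGridded S) : HNPersistence.IsGridded S (quot A B) := by
  refine ⟨fun q => ?_, fun q hq => ?_, fun p q f hpq => ⟨?_, fun x => ?_⟩⟩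
  · have := hV.finite q
    exact inferInstanceAs (Module.Finite K (B.space q ⧸ (A.space q).comap (B.space q).subtype))
  · have := hV.subsingleton q hq
    exact inferInstanceAs (Subsingleton (B.space q ⧸ (A.space q).comap (B.space q).subtype))
  · rw [injective_iff_map_eq_zero]
    intro x hx
    obtain ⟨x, rfl⟩ := Submodule.mkQ_surjective _ x
    have h1 : (V.map f).hom x.1 ∈ A.space q :=
      (Submodule.Quotient.mk_eq_zero ((A.space q).comap (B.space q).subtype)).1 hx
    obtain ⟨a, ha, hax⟩ := hA p q f hpq h1
    obtain rfl := (hV.bijective p q f hpq).1 hax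
    exact (Submodule.Quotient.mk_eq_zero ((A.space p).comap (B.space p).subtype)).2 ha
  · obtain ⟨⟨x, hx⟩, rfl⟩ := Submodule.mkQ_surjective _ x
    obtain ⟨y, hy, rfl⟩ := hB p q f hpq hx
    exact ⟨Submodule.Quotient.mk ⟨y, hy⟩, rfl⟩

theorem IsGridded.quotLift (hAB : A ≤ B) (hA : A.IsGridded S) {X : PersSub (PersSub.quot A B)} (hX : X.IsGridded S) :
    (PersSub.quotLift A B X).IsGridded S := by
  rintro p q f hpq _ ⟨x, hx, rfl⟩
  obtain ⟨y, hy, hyx⟩ := hX p q f hpq hx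
  obtain ⟨y, rfl⟩ := Submodule.mkQ_surjective _ y
  have h1 : x.1 - (V.map f).hom y.1 ∈ A.space q :=
    (Submodule.Quotient.eq ((A.space q).comap (B.space q).subtype)).1 hyx.symm
  obtain ⟨a, ha, hax⟩ := hA p q f hpq h1
  refine ⟨a + y.1, add_mem (le_quotLift hAB X p ha) ⟨y, hy, rfl⟩, ?_⟩
  rw [map_add, hax]
  exact sub_add_cancel _ _

theorem IsGridded.quotSub {C : PersSub V} (hV : HNPersistence.IsGridded S V)
    (hB : B.IsGridded S) (hC : C.IsGridded S) : (quotSub A B C).IsGridded S := by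
  rintro p q f hpq _ ⟨x, hx, rfl⟩
  obtain ⟨y, ⟨hyB, hyC⟩, hyx⟩ := (hB.inf hV hC) p q f hpq ⟨x.2, hx⟩
  refine ⟨Submodule.Quotient.mk ⟨y, hyB⟩, ⟨⟨y, hyB⟩, hyC, rfl⟩, ?_⟩
  obtain ⟨x, hx'⟩ := x
  obtain rfl := hyx
  rfl

theorem isGridded_bot (S : Finset T) : (⊥ : PersSub V).IsGridded S := by
  rintro p q f - x hx
  exact ⟨0, zero_mem _, by rw [map_zero]; exact ((Submodule.mem_bot K).1 hx).symm⟩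

theorem isGridded_top (hV : HNPersistence.IsGridded S V) : (⊤ : PersSub V).IsGridded S := by
  rintro p q f hpq x -
  obtain ⟨y, rfl⟩ := (hV.bijective p q f hpq).2 x
  exact ⟨y, trivial, rfl⟩

theorem isFP_bot (hV : IsFP V) : IsFP (⊥ : PersSub V).toPers := by
  obtain ⟨S, hS⟩ := isFP_iff_exists_isGridded.1 hV
  exact (isFP_toPers_iff hV).2 ⟨S, hS, isGridded_bot S⟩

theorem isFP_inf (hV : IsFP V) (hA : IsFP A.toPers) (hB : IsFP B.toPers) :
    IsFP (A ⊓ B).toPers := by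
  obtain ⟨S, hS, hA, hB⟩ := exists_common_grid hV hA hB
  exact (isFP_toPers_iff hV).2 ⟨S, hS, hA.inf hS hB⟩

theorem isFP_sup (hV : IsFP V) (hA : IsFP A.toPers) (hB : IsFP B.toPers) :
    IsFP (A ⊔ B).toPers := by
  obtain ⟨S, hS, hA, hB⟩ := exists_common_grid hV hA hB
  exact (isFP_toPers_iff hV).2 ⟨S, hS, hA.sup hB⟩

theorem isFP_map (φ : V ⟶ W) (hV : IsFP V) (hW : IsFP W) (hA : IsFP A.toPers) :
    IsFP (A.map φ).toPers := by
  classical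
  obtain ⟨S, hS, hA⟩ := (isFP_toPers_iff hV).1 hA
  obtain ⟨S', hS'⟩ := isFP_iff_exists_isGridded.1 hW
  exact (isFP_toPers_iff hW).2 ⟨S ∪ S', hS'.mono Finset.subset_union_right,
    (hA.map φ).mono Finset.subset_union_left⟩

theorem isFP_comap (φ : V ⟶ W) (hV : IsFP V) (hW : IsFP W) {B : PersSub W}
    (hB : IsFP B.toPers) : IsFP (B.comap φ).toPers := by
  classical
  obtain ⟨S, hS, hB⟩ := (isFP_toPers_iff hW).1 hB
  obtain ⟨S', hS'⟩ := isFP_iff_exists_isGridded.1 hV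
  have h := hS'.mono (Finset.subset_union_right (s₁ := S))
  exact (isFP_toPers_iff hV).2 ⟨S ∪ S', h, IsGridded.comap φ h
    (hS.mono Finset.subset_union_left) (hB.mono Finset.subset_union_left)⟩

theorem isFP_quot (hV : IsFP V) (hA : IsFP A.toPers) (hB : IsFP B.toPers) :
    IsFP (PersSub.quot A B) := by
  obtain ⟨S, hS, hA, hB⟩ := exists_common_grid hV hA hB
  exact isFP_iff_exists_isGridded.2 ⟨S, hA.quot hS hB⟩

theorem isFP_quotLift (hAB : A ≤ B) (hV : IsFP V) (hA : IsFP A.toPers) (hB : IsFP B.toPers)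
    {X : PersSub (PersSub.quot A B)} (hX : IsFP X.toPers) :
    IsFP (PersSub.quotLift A B X).toPers := by
  classical
  obtain ⟨S, hS, hA', -⟩ := exists_common_grid hV hA hB
  obtain ⟨S', -, hX⟩ := (isFP_toPers_iff (isFP_quot hV hA hB)).1 hX
  have h := hS.mono (Finset.subset_union_left (s₂ := S'))
  exact (isFP_toPers_iff hV).2 ⟨S ∪ S', h, IsGridded.quotLift hAB
    (hA'.mono Finset.subset_union_left) (hX.mono Finset.subset_union_right)⟩

theorem isFP_quotSub {C : PersSub V} (hV : IsFP V) (hA : IsFP A.toPers) (hB : IsFP B.toPers)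
    (hC : IsFP C.toPers) : IsFP (PersSub.quotSub A B C).toPers := by
  classical
  obtain ⟨S, hS, hA', hB'⟩ := exists_common_grid hV hA hB
  obtain ⟨S', -, hC⟩ := (isFP_toPers_iff hV).1 hC
  have h := hS.mono (Finset.subset_union_left (s₂ := S'))
  have hB'' := hB'.mono (Finset.subset_union_left (s₂ := S'))
  exact (isFP_toPers_iff (isFP_quot hV hA hB)).2 ⟨S ∪ S', IsGridded.quot h
    (hA'.mono Finset.subset_union_left) hB'', IsGridded.quotSub h hB''
    (hC.mono Finset.subset_union_right)⟩

end PersSub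

theorem IsFP.finite (hV : IsFP V) (q : Fin n → T) : Module.Finite K (V.obj q) := by
  obtain ⟨S, hS⟩ := isFP_iff_exists_isGridded.1 hV
  exact hS.finite q

end SubGridded

/-! ### Stability conditions on submodules -/

/-- The values of the stability condition depend only on dimension vectors. -/
def StabilityCondition.IsDimInvariant {K : Type u} [Field K] {Q : Type} [PartialOrder Q]
    (Z : StabilityCondition K Q) : Prop :=
  ∀ V W : Pers K Q, IsFP V → IsFP W → dimVec V = dimVec W → Z.val V = Z.val W

/-- The modular function `A ↦ Im Z(A) - θ Re Z(A)` on submodules. A submodule has slope at least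
`θ` if and only if this is nonnegative. -/
def level {K : Type u} [Field K] {Q : Type} [PartialOrder Q] {V : Pers K Q}
    (Z : StabilityCondition K Q) (θ : ℝ) (A : PersSub V) : ℝ :=
  (Z.val A.toPers).im - θ * (Z.val A.toPers).re

section Values

variable {K : Type u} [Field K] {n : ℕ} {T : Type} [LinearOrder T]
  {V W : Pers K (Fin n → T)} {Z : StabilityCondition K (Fin n → T)} {A B : PersSub V}

theorem val_eq_val_add_val_quot (hV : IsFP V) (hA : IsFP A.toPers) (hB : IsFP B.toPers)
    (h : A ≤ B) : Z.val B.toPers = Z.val A.toPers + Z.val (PersSub.quot A B) :=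
  Z.additive (quotSequence h) (quotSequence_shortExact h) hA hB (PersSub.isFP_quot hV hA hB)

theorem re_quot_pos (hV : IsFP V) (hA : IsFP A.toPers) (hB : IsFP B.toPers) (h : A < B) :
    0 < (Z.val (PersSub.quot A B)).re :=
  Z.re_pos _ (PersSub.isFP_quot hV hA hB) (not_isZero_quot h)

theorem re_val_lt (hV : IsFP V) (hA : IsFP A.toPers) (hB : IsFP B.toPers) (h : A < B) :
    (Z.val A.toPers).re < (Z.val B.toPers).re := by
  rw [val_eq_val_add_val_quot hV hA hB h.le, Complex.add_re]
  linarith [re_quot_pos (Z := Z) hV hA hB h]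

theorem re_val_le (hV : IsFP V) (hA : IsFP A.toPers) (hB : IsFP B.toPers) (h : A ≤ B) :
    (Z.val A.toPers).re ≤ (Z.val B.toPers).re := by
  rcases h.eq_or_lt with rfl | h
  · exact le_rfl
  · exact (re_val_lt hV hA hB h).le

theorem val_sup_add_val_inf (hZ : Z.IsDimInvariant) (hV : IsFP V) (hA : IsFP A.toPers)
    (hB : IsFP B.toPers) :
    Z.val (A ⊔ B).toPers + Z.val (A ⊓ B).toPers = Z.val A.toPers + Z.val B.toPers := by
  have hs := PersSub.isFP_sup hV hA hB
  have hi := PersSub.isFP_inf hV hA hB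
  rw [val_eq_val_add_val_quot hV hB hs le_sup_right, val_eq_val_add_val_quot hV hi hA inf_le_left,
    hZ (PersSub.quot B (A ⊔ B)) (PersSub.quot (A ⊓ B) A) (PersSub.isFP_quot hV hB hs)
      (PersSub.isFP_quot hV hi hA)]
  · ring
  · funext q
    have := hV.finite q
    have h1 := finrank_quot_add (le_sup_right : B ≤ A ⊔ B) q
    have h2 := finrank_quot_add (inf_le_left : A ⊓ B ≤ A) q
    have h3 := Submodule.finrank_sup_add_finrank_inf_eq (A.space q) (B.space q)
    rw [PersSub.sup_space] at h1
    rw [PersSub.inf_space] at h2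
    omega

theorem level_sup_add_level_inf (hZ : Z.IsDimInvariant) (hV : IsFP V) (θ : ℝ)
    (hA : IsFP A.toPers) (hB : IsFP B.toPers) :
    level Z θ (A ⊔ B) + level Z θ (A ⊓ B) = level Z θ A + level Z θ B := by
  have h := val_sup_add_val_inf hZ hV hA hB
  have h1 := congrArg Complex.re h
  have h2 := congrArg Complex.im h
  rw [Complex.add_re, Complex.add_re] at h1
  rw [Complex.add_im, Complex.add_im] at h2
  unfold level
  linear_combination h2 - θ * h1

theorem level_eq_level_add (θ : ℝ) (hV : IsFP V) (hA : IsFP A.toPers) (hB : IsFP B.toPers)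
    (h : A ≤ B) : level Z θ B = level Z θ A +
      ((Z.val (PersSub.quot A B)).im - θ * (Z.val (PersSub.quot A B)).re) := by
  unfold level
  rw [val_eq_val_add_val_quot hV hA hB h, Complex.add_re, Complex.add_im]
  ring

theorem slope_le_iff (hV : IsFP V) (hA : IsFP A.toPers) (hB : IsFP B.toPers) (h : A < B)
    (θ : ℝ) : slope Z (PersSub.quot A B) ≤ θ ↔ level Z θ B ≤ level Z θ A := by
  rw [slope, div_le_iff₀ (re_quot_pos hV hA hB h), level_eq_level_add θ hV hA hB h.le]
  constructor <;> intro h <;> linarith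

theorem lt_slope_iff (hV : IsFP V) (hA : IsFP A.toPers) (hB : IsFP B.toPers) (h : A < B)
    (θ : ℝ) : θ < slope Z (PersSub.quot A B) ↔ level Z θ A < level Z θ B := by
  rw [← not_le, slope_le_iff hV hA hB h, not_le]

theorem level_slope (hV : IsFP V) (hA : IsFP A.toPers) (hB : IsFP B.toPers) (h : A < B) :
    level Z (slope Z (PersSub.quot A B)) B = level Z (slope Z (PersSub.quot A B)) A := by
  rw [level_eq_level_add _ hV hA hB h.le, slope,
    div_mul_cancel₀ _ (re_quot_pos hV hA hB h).ne']
  ring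

theorem level_sub_level (θ θ' : ℝ) :
    level Z θ B - level Z θ A = level Z θ' B - level Z θ' A +
      (θ' - θ) * ((Z.val B.toPers).re - (Z.val A.toPers).re) := by
  unfold level
  ring

theorem PersSub.eq_bot_of_isZero (h : IsZero A.toPers) : A = ⊥ := by
  refine le_bot_iff.1 fun q x hx => ?_
  have : Subsingleton (A.space q) := (isZero_iff_subsingleton _).1 h q
  exact (Submodule.mem_bot K).2 (congrArg Subtype.val (Subsingleton.elim (⟨x, hx⟩ : A.space q) 0))

theorem PersSub.isZero_bot : IsZero (⊥ : PersSub V).toPers :=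
  (isZero_iff_subsingleton _).2 fun q =>
    inferInstanceAs (Subsingleton (⊥ : Submodule K (V.obj q)))

theorem dimVec_quot_quotLift (hV : IsFP V) (h : A ≤ B) (X : PersSub (PersSub.quot A B)) :
    dimVec (PersSub.quot A (PersSub.quotLift A B X)) = dimVec X.toPers := by
  funext q
  have := hV.finite q
  have h1 := finrank_quot_add (PersSub.le_quotLift h X) q
  have h2 := finrank_quotLift h X q
  change _ = Module.finrank K (X.space q)
  omega

theorem dimVec_eq_zero_of_isZero {U : Pers K (Fin n → T)} (h : IsZero U) : dimVec U = 0 := by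
  funext q
  have := (isZero_iff_subsingleton _).1 h q
  exact Module.finrank_zero_of_subsingleton

/-- A subquotient `B / A` is semistable if and only if it has slope at least that of `W / A` for
all finitely presentable `W` between `A` and `B`. -/
theorem isSemistable_quot_iff (hZ : Z.IsDimInvariant) (hV : IsFP V) (hA : IsFP A.toPers)
    (hB : IsFP B.toPers) (h : A < B) :
    IsSemistable Z (PersSub.quot A B) ↔ ∀ C : PersSub V, IsFP C.toPers → A ≤ C → C ≤ B →
      level Z (slope Z (PersSub.quot A B)) C ≤ level Z (slope Z (PersSub.quot A B)) A := by
  have hQ := PersSub.isFP_quot hV hA hB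
  have key : ∀ X : PersSub (PersSub.quot A B), IsFP X.toPers →
      slope Z X.toPers = slope Z (PersSub.quot A (PersSub.quotLift A B X)) := fun X hX => by
    rw [slope, slope, hZ _ _ hX (PersSub.isFP_quot hV hA
      (PersSub.isFP_quotLift h.le hV hA hB hX)) (dimVec_quot_quotLift hV h.le X).symm]
  constructor
  · rintro ⟨-, -, hs⟩ C hC hAC hCB
    rcases hAC.eq_or_lt with rfl | hAC
    · exact le_rfl
    have hX := PersSub.isFP_quotSub hV hA hB hC
    have hl := PersSub.quotLift_quotSub hAC.le hCB
    have h1 := hs _ hX ?_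
    · rw [key _ hX, hl, slope_le_iff hV hA hC hAC] at h1
      exact h1
    · intro h0
      have hpos := re_quot_pos (Z := Z) hV hA hC hAC
      have hZ0 : Z.val (PersSub.quot A C) = Z.val (⊥ : PersSub V).toPers := by
        refine hZ _ _ (PersSub.isFP_quot hV hA hC) (PersSub.isFP_bot hV) ?_
        conv_lhs => rw [← hl]
        rw [dimVec_quot_quotLift hV h.le, h0, dimVec_eq_zero_of_isZero PersSub.isZero_bot,
          dimVec_eq_zero_of_isZero PersSub.isZero_bot]
      have hZ1 := val_eq_val_add_val_quot (Z := Z) hV hA hC hAC.le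
      have hb := PersSub.isFP_bot hV
      have hZ2 := val_eq_val_add_val_quot (Z := Z) hV hb hb le_rfl
      rw [hZ (PersSub.quot (⊥ : PersSub V) ⊥) (⊥ : PersSub V).toPers
        (PersSub.isFP_quot hV hb hb) hb] at hZ2
      · rw [hZ0, add_eq_left.1 hZ2.symm] at hpos
        exact lt_irrefl _ hpos
      · funext q
        have := hV.finite q
        have h1 := finrank_quot_add (le_refl (⊥ : PersSub V)) q
        rw [dimVec_eq_zero_of_isZero PersSub.isZero_bot]
        exact (add_eq_right (b := Module.finrank K ((⊥ : PersSub V).space q))).1 h1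
  · intro hs
    refine ⟨hQ, not_isZero_quot h, fun X hX hX0 => ?_⟩
    have hL := PersSub.isFP_quotLift h.le hV hA hB hX
    have hAL := PersSub.le_quotLift h.le X
    have h1 := hs _ hL hAL (PersSub.quotLift_le _ _ _)
    rw [key _ hX]
    refine (slope_le_iff hV hA hL (hAL.lt_of_ne fun h2 => hX0 ?_) _).2 h1
    refine PersSub.eq_bot_of_isZero ?_
    rw [isZero_iff_subsingleton]
    intro q
    have := hV.finite q
    have h3 := finrank_quotLift h.le X q
    rw [← h2, right_eq_add] at h3
    have := hQ.finite q
    exact (Module.finrank_zero_iff (R := K) (M := X.space q)).1 h3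

end Values

/-! ### Uniqueness of Harder-Narasimhan filtrations -/

section Uniqueness

variable {K : Type u} [Field K] {n : ℕ} {T : Type} [LinearOrder T]
  {V W : Pers K (Fin n → T)} {Z : StabilityCondition K (Fin n → T)} {A B C : PersSub V}

theorem level_sup_mono (hZ : Z.IsDimInvariant) (hV : IsFP V) (hA : IsFP A.toPers)
    (hB : IsFP B.toPers) (hC : IsFP C.toPers) (h : A < B)
    (hs : IsSemistable Z (PersSub.quot A B)) {θ : ℝ} (hθ : θ ≤ slope Z (PersSub.quot A B)) :
    level Z θ (C ⊔ A) ≤ level Z θ (C ⊔ B) := by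
  have hCA := PersSub.isFP_sup hV hC hA
  have hD := PersSub.isFP_inf hV hCA hB
  have h1 := (isSemistable_quot_iff hZ hV hA hB h).1 hs _ hD (le_inf le_sup_right h.le)
    inf_le_right
  have h2 := level_sup_add_level_inf (Z := Z) hZ hV θ hCA hB
  rw [sup_assoc, sup_eq_right.2 h.le] at h2
  rw [← level_slope hV hA hB h] at h1
  have h3 := level_sub_level (Z := Z) (A := (C ⊔ A) ⊓ B) (B := B) θ (slope Z (PersSub.quot A B))
  have h4 := re_val_le (Z := Z) hV hD hB inf_le_right
  have h5 := mul_nonneg (sub_nonneg.2 hθ) (sub_nonneg.2 h4)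
  linarith

theorem level_inf_anti (hZ : Z.IsDimInvariant) (hV : IsFP V) (hA : IsFP A.toPers)
    (hB : IsFP B.toPers) (hC : IsFP C.toPers) (h : A < B)
    (hs : IsSemistable Z (PersSub.quot A B)) {θ : ℝ} (hθ : slope Z (PersSub.quot A B) < θ) :
    level Z θ (C ⊓ B) ≤ level Z θ (C ⊓ A) ∧
      (level Z θ (C ⊓ B) = level Z θ (C ⊓ A) → C ⊓ B ≤ A) := by
  have hCB := PersSub.isFP_inf hV hC hB
  have hD := PersSub.isFP_sup hV hCB hA
  have h1 := (isSemistable_quot_iff hZ hV hA hB h).1 hs _ hD le_sup_right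
    (sup_le inf_le_right h.le)
  have h2 := level_sup_add_level_inf (Z := Z) hZ hV θ hCB hA
  rw [inf_assoc, inf_eq_right.2 h.le] at h2
  have h3 := level_sub_level (Z := Z) (A := A) (B := (C ⊓ B) ⊔ A) θ (slope Z (PersSub.quot A B))
  by_cases hle : C ⊓ B ≤ A
  · have : C ⊓ B = C ⊓ A := le_antisymm (le_inf inf_le_left hle) (inf_le_inf_left _ h.le)
    rw [this]
    exact ⟨le_rfl, fun _ => inf_le_right⟩
  · have h4 := re_val_lt (Z := Z) hV hA hD (right_lt_sup.2 hle)
    have h5 := mul_pos (sub_pos.2 hθ) (sub_pos.2 h4)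
    exact ⟨by linarith, fun h6 => by linarith⟩

/-- The submodule `A` maximises `level Z θ` among the finitely presentable submodules, and
contains all maximisers. -/
def IsLargestMaximiser (Z : StabilityCondition K (Fin n → T)) (θ : ℝ) (A : PersSub V) : Prop :=
  IsFP A.toPers ∧ ∀ B : PersSub V, IsFP B.toPers →
    level Z θ B ≤ level Z θ A ∧ (level Z θ B = level Z θ A → B ≤ A)

theorem IsLargestMaximiser.unique {θ : ℝ} (hA : IsLargestMaximiser Z θ A)
    (hB : IsLargestMaximiser Z θ B) : A = B := by
  have h := le_antisymm (hA.2 B hB.1).1 (hB.2 A hA.1).1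
  exact le_antisymm ((hB.2 A hA.1).2 h.symm) ((hA.2 B hB.1).2 h)

/-- The part of slope at least `θ` of a Harder-Narasimhan filtration does not depend on the
filtration: it is the largest maximiser of `level Z θ`. For `B` finitely presentable, adding to
`B` the steps of slope at least `θ` does not decrease the level, and then intersecting with the
steps in decreasing order down to the required one does not either. -/
theorem IsHNPart.isLargestMaximiser (hZ : Z.IsDimInvariant) (hV : IsFP V) {θ : ℝ}
    (h : IsHNPart Z θ V A) : IsLargestMaximiser Z θ A := by
  obtain ⟨F, hF, i, rfl, hi, hi'⟩ := h
  have hle : ∀ j : Fin F.length, j.succ ≤ i → θ ≤ slope Z (gr F j) := by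
    intro j hj
    rcases hj.eq_or_lt with hj | hj
    · exact hi j hj
    · obtain ⟨k, rfl⟩ := Fin.exists_succ_eq.2 (Fin.ne_zero_of_lt hj)
      exact (hi k rfl).trans (hF.slope_anti (Fin.succ_lt_succ_iff.1 hj)).le
  have hlt : ∀ j : Fin F.length, i ≤ j.castSucc → slope Z (gr F j) < θ := by
    intro j hj
    rcases hj.eq_or_lt with hj | hj
    · exact hi' j hj.symm
    · obtain ⟨k, rfl⟩ := Fin.exists_castSucc_eq.2 (Fin.ne_last_of_lt hj)
      exact (hF.slope_anti (Fin.castSucc_lt_castSucc_iff.1 hj)).trans (hi' k rfl)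
  have h0 : F 0 = ⊥ := hF.head_eq
  have hup : ∀ B : PersSub V, IsFP B.toPers → ∀ k, k ≤ i →
      level Z θ B ≤ level Z θ (B ⊔ F k) := by
    intro B hB k
    induction k using Fin.induction with
    | zero => intro _; rw [h0, sup_bot_eq]
    | succ j ih =>
      intro hj
      exact (ih (j.castSucc_le_succ.trans hj)).trans (level_sup_mono hZ hV (hF.isFP _)
        (hF.isFP _) hB (F.step j) (hF.semistable j) (hle j hj))
  have hdown : ∀ B : PersSub V, IsFP B.toPers → ∀ k, i ≤ k →
      level Z θ (B ⊓ F k) ≤ level Z θ (B ⊓ F i) ∧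
        (level Z θ (B ⊓ F k) = level Z θ (B ⊓ F i) → B ⊓ F k ≤ F i) := by
    intro B hB k
    induction k using Fin.induction with
    | zero =>
      intro hk
      rw [Fin.le_zero_iff.1 hk]
      exact ⟨le_rfl, fun _ => inf_le_right⟩
    | succ j ih =>
      intro hj
      rcases hj.eq_or_lt with hj | hj
      · rw [hj]
        exact ⟨le_rfl, fun _ => inf_le_right⟩
      · have hj := Fin.le_castSucc_iff.2 hj
        have h1 := ih hj
        have h2 := level_inf_anti hZ hV (hF.isFP _) (hF.isFP _) hB (F.step j) (hF.semistable j)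
          (hlt j hj)
        refine ⟨h2.1.trans h1.1, fun h3 => ?_⟩
        have h4 := h2.2 (by linarith [h2.1, h1.1])
        exact (le_inf inf_le_left h4).trans (h1.2 (by linarith [h2.1, h1.1]))
  refine ⟨hF.isFP i, fun B hB => ?_⟩
  have h1 := hup B hB i le_rfl
  have h2 := hdown _ (PersSub.isFP_sup hV hB (hF.isFP i)) (Fin.last _) (Fin.le_last i)
  have hlast : F (Fin.last _) = ⊤ := hF.last_eq
  rw [hlast, inf_top_eq, inf_eq_right.2 (le_sup_right : F i ≤ B ⊔ F i)] at h2
  exact ⟨h1.trans h2.1, fun h3 => le_sup_left.trans (h2.2 (by linarith [h2.1]))⟩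

theorem exists_isHNPart {F : LTSeries (PersSub V)} (hF : IsHNFiltration Z V F) (θ : ℝ) :
    ∃ i, IsHNPart Z θ V (F i) := by
  let s : Set (Fin (F.length + 1)) := {i | ∀ j : Fin F.length, j.succ ≤ i → θ ≤ slope Z (gr F j)}
  obtain ⟨i, hi, hmax⟩ := s.toFinite.exists_maximal
    ⟨0, fun j hj => absurd (Fin.le_zero_iff.1 hj) (Fin.succ_ne_zero j)⟩
  refine ⟨i, F, hF, i, rfl, fun j hj => hi j hj.le, fun j hj => ?_⟩
  by_contra hθ
  have : j.succ ∈ s := by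
    intro k hk
    rcases hk.eq_or_lt with hk | hk
    · rw [Fin.succ_injective _ hk]
      exact not_lt.1 hθ
    · rw [← hj] at hi
      exact hi k (Fin.le_castSucc_iff.2 hk)
  have := hmax this (hj ▸ j.castSucc_le_succ)
  rw [← hj] at this
  exact absurd this (not_le.2 j.castSucc_lt_succ)

theorem IsHNFiltration.exists_isHNPart {F : LTSeries (PersSub V)} (hF : IsHNFiltration Z V F)
    (i : Fin (F.length + 1)) : ∃ θ, IsHNPart Z θ V (F i) := by
  rcases Fin.eq_zero_or_eq_succ i with rfl | ⟨j, rfl⟩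
  · by_cases h0 : ∃ j : Fin F.length, j.castSucc = 0
    · obtain ⟨j, hj⟩ := h0
      refine ⟨slope Z (gr F j) + 1, F, hF, 0, rfl, fun k hk => absurd hk (Fin.succ_ne_zero k),
        fun k hk => ?_⟩
      obtain rfl := Fin.castSucc_injective _ (hk.trans hj.symm)
      exact lt_add_one _
    · exact ⟨0, F, hF, 0, rfl, fun k hk => absurd hk (Fin.succ_ne_zero k),
        fun k hk => absurd ⟨k, hk⟩ h0⟩
  · refine ⟨slope Z (gr F j), F, hF, j.succ, rfl, fun k hk => ?_, fun k hk => ?_⟩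
    · rw [Fin.succ_injective _ hk]
    · refine hF.slope_anti ?_
      rw [← Fin.castSucc_lt_castSucc_iff, hk]
      exact j.castSucc_lt_succ

theorem IsHNFiltration.unique (hZ : Z.IsDimInvariant) (hV : IsFP V) {F F' : LTSeries (PersSub V)}
    (hF : IsHNFiltration Z V F) (hF' : IsHNFiltration Z V F') : F = F' := by
  have key : ∀ {F F' : LTSeries (PersSub V)}, IsHNFiltration Z V F → IsHNFiltration Z V F' →
      Set.range F ⊆ Set.range F' := by
    rintro F F' hF hF' _ ⟨i, rfl⟩
    obtain ⟨θ, hθ⟩ := hF.exists_isHNPart i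
    obtain ⟨i', hi'⟩ := HNPersistence.exists_isHNPart hF' θ
    exact ⟨i', (hi'.isLargestMaximiser hZ hV).unique (hθ.isLargestMaximiser hZ hV)⟩
  have hr := (key hF hF').antisymm (key hF' hF)
  have hm := F.strictMono
  have hm' := F'.strictMono
  have hlen : F.length = F'.length := by
    have h1 := Nat.card_range_of_injective hm.injective
    have h2 := Nat.card_range_of_injective hm'.injective
    rw [Nat.card_fin] at h1 h2
    have h3 : Nat.card (Set.range F) = Nat.card (Set.range F') := by rw [hr]
    omega
  clear hF hF' key
  obtain ⟨l, f, hf⟩ := F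
  obtain ⟨l', f', hf'⟩ := F'
  obtain rfl : l = l' := hlen
  obtain rfl : f = f' := (StrictMono.range_inj hm hm').1 hr
  rfl

theorem hnPart_isLargestMaximiser (hZ : Z.IsDimInvariant) (hV : IsFP V)
    (h : ∃ F, IsHNFiltration Z V F) (θ : ℝ) : IsLargestMaximiser Z θ (hnPart Z θ V) := by
  obtain ⟨F, hF⟩ := h
  obtain ⟨i, hi⟩ := exists_isHNPart hF θ
  have hex : ∃ A, IsHNPart Z θ V A := ⟨_, hi⟩
  rw [hnPart, dif_pos hex]
  exact hex.choose_spec.isLargestMaximiser hZ hV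

end Uniqueness

/-! ### Existence of Harder-Narasimhan filtrations -/

section Existence

variable {K : Type u} [Field K] {n : ℕ} {T : Type} [LinearOrder T]
  {V : Pers K (Fin n → T)} {Z : StabilityCondition K (Fin n → T)} {S : Finset T}

/-- Every finitely presentable submodule `W` can be replaced with a submodule discretised by the
fixed grid `S ^ n`, without losing the discretised submodules that `W` contains nor decreasing
`Im Z - θ Re Z`. -/
def IsDiscretisable (Z : StabilityCondition K (Fin n → T)) (V : Pers K (Fin n → T))
    (S : Finset T) : Prop :=
  ∀ (θ : ℝ) (W U : PersSub V), IsFP W.toPers → U.IsGridded S → U ≤ W →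
    ∃ W' : PersSub V, W'.IsGridded S ∧ U ≤ W' ∧ level Z θ W ≤ level Z θ W'

/-- The submodules discretised by a fixed finite grid have finitely many dimension vectors. -/
theorem finite_val_gridded (hZ : Z.IsDimInvariant) (hV : IsGridded S V) :
    ((fun A : PersSub V => Z.val A.toPers) '' {A | A.IsGridded S}).Finite := by
  classical
  have hfin := hV.finite
  have hFP := isFP_iff_exists_isGridded.2 ⟨S, hV⟩
  -- The dimensions at the grid points determine the dimension vector.
  let d : PersSub V → (p : Fin n → S) →
      Fin (Module.finrank K (V.obj fun i => (p i : T)) + 1) := fun A p =>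
    ⟨Module.finrank K (A.space fun i => (p i : T)), Nat.lt_succ_of_le (Submodule.finrank_le _)⟩
  have key : ∀ A B : PersSub V, A.IsGridded S → B.IsGridded S → d A = d B →
      Z.val A.toPers = Z.val B.toPers := by
    intro A B hA hB hd
    have hA' := (PersSub.isGridded_toPers_iff hV).2 hA
    have hB' := (PersSub.isGridded_toPers_iff hV).2 hB
    refine hZ _ _ (isFP_iff_exists_isGridded.2 ⟨_, hA'⟩)
      (isFP_iff_exists_isGridded.2 ⟨_, hB'⟩) (funext fun q => ?_)
    by_cases hq : ∃ i, ∀ s ∈ S, ¬ s ≤ q i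
    · have := hA'.subsingleton q hq
      have := hB'.subsingleton q hq
      exact (Module.finrank_zero_of_subsingleton).trans Module.finrank_zero_of_subsingleton.symm
    · push Not at hq
      obtain ⟨p, hpq, hc⟩ := exists_floor S q hq
      have h1 := (LinearEquiv.ofBijective _ (hA'.bijective _ q (homOfLE hpq) hc)).finrank_eq
      have h2 := (LinearEquiv.ofBijective _ (hB'.bijective _ q (homOfLE hpq) hc)).finrank_eq
      exact h1.symm.trans ((congrArg Fin.val (congrFun hd p)).trans h2)
  refine Set.Finite.of_finite_image (f := fun z => {x | ∃ A : PersSub V, A.IsGridded S ∧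
    Z.val A.toPers = z ∧ d A = x}) (Set.toFinite _) ?_
  rintro _ ⟨A, hA, rfl⟩ _ ⟨B, hB, rfl⟩ hAB
  have : d A ∈ {x | ∃ A : PersSub V, A.IsGridded S ∧ Z.val A.toPers = Z.val B.toPers ∧ d A = x} :=
    (Set.ext_iff.1 hAB (d A)).1 ⟨A, hA, rfl, rfl⟩
  obtain ⟨C, hC, hCB, hCA⟩ := this
  exact (key A C hA hC hCA.symm).trans hCB

/-- The next step of the filtration after `U`: the largest of the discretised submodules `W`
which contain `U` and for which the slope of `W / U` is maximal. -/
theorem exists_next_step (hZ : Z.IsDimInvariant) (hV : IsGridded S V)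
    (hS : IsDiscretisable Z V S) {U : PersSub V} (hU : U.IsGridded S) (hne : U ≠ ⊤) :
    ∃ W : PersSub V, W.IsGridded S ∧ U < W ∧
      (∀ C : PersSub V, IsFP C.toPers → U ≤ C →
        level Z (slope Z (PersSub.quot U W)) C ≤ level Z (slope Z (PersSub.quot U W)) U) ∧
      (∀ C : PersSub V, C.IsGridded S → W < C →
        slope Z (PersSub.quot W C) < slope Z (PersSub.quot U W)) := by
  have hFP := isFP_iff_exists_isGridded.2 ⟨S, hV⟩
  have hG : ∀ {A : PersSub V}, A.IsGridded S → IsFP A.toPers := fun hA =>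
    (PersSub.isFP_toPers_iff hFP).2 ⟨S, hV, hA⟩
  let t : Set (PersSub V) := {W | W.IsGridded S ∧ U < W}
  -- Maximise the slope first, and then `Re Z`, which is strictly monotone.
  let f : PersSub V → ℝ ×ₗ ℝ := fun W =>
    toLex (slope Z (PersSub.quot U W), (Z.val W.toPers).re)
  have hfin : (f '' t).Finite := by
    refine ((finite_val_gridded hZ hV).image fun z => (toLex
      ((z - Z.val U.toPers).im / (z - Z.val U.toPers).re, z.re) : ℝ ×ₗ ℝ)).subset ?_
    rintro _ ⟨W, ⟨hW, hUW⟩, rfl⟩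
    refine ⟨_, ⟨W, hW, rfl⟩, ?_⟩
    simp only [f, slope]
    rw [val_eq_val_add_val_quot hFP (hG hU) (hG hW) hUW.le, add_sub_cancel_left]
  obtain ⟨W, ⟨hW, hUW⟩, hmax⟩ := hfin.exists_maximalFor' f t
    ⟨⊤, PersSub.isGridded_top hV, lt_top_iff_ne_top.2 hne⟩
  have hmax' : ∀ C ∈ t, f C ≤ f W := fun C hC => by
    rcases le_total (f C) (f W) with h | h
    · exact h
    · exact hmax hC h
  have hslope : ∀ C ∈ t, slope Z (PersSub.quot U C) ≤ slope Z (PersSub.quot U W) :=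
    fun C hC => by
      rcases Prod.Lex.le_iff.1 (hmax' C hC) with h | h
      · exact h.le
      · exact h.1.le
  refine ⟨W, hW, hUW, fun C hC hUC => ?_, fun C hC hWC => ?_⟩
  · by_contra! hlt
    obtain ⟨C', hC', hUC', hle⟩ := hS (slope Z (PersSub.quot U W)) C U hC hU hUC
    have hlt' := hlt.trans_le hle
    have hUC'' : U < C' := hUC'.lt_of_ne (by rintro rfl; exact lt_irrefl _ hlt')
    rw [← lt_slope_iff hFP (hG hU) (hG hC') hUC''] at hlt'
    exact absurd (hslope C' ⟨hC', hUC''⟩) (not_le.2 hlt')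
  · have hCt : C ∈ t := ⟨hC, hUW.trans hWC⟩
    have hre := re_val_lt (Z := Z) hFP (hG hW) (hG hC) hWC
    have hlt : slope Z (PersSub.quot U C) < slope Z (PersSub.quot U W) := by
      rcases Prod.Lex.le_iff.1 (hmax' C hCt) with h | h
      · exact h
      · exact absurd h.2 (not_le.2 hre)
    by_contra! hle
    have h1 := (lt_slope_iff hFP (hG hU) (hG hC) hCt.2 (slope Z (PersSub.quot U W))).not.1
      (not_lt.2 hlt.le)
    have h2 := level_slope (Z := Z) hFP (hG hU) (hG hW) hUW
    have h3 := level_slope (Z := Z) hFP (hG hU) (hG hC) hCt.2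
    have h4 := level_slope (Z := Z) hFP (hG hW) (hG hC) hWC
    have h5 := level_sub_level (Z := Z) (A := U) (B := C) (slope Z (PersSub.quot U W))
      (slope Z (PersSub.quot U C))
    have h6 := level_sub_level (Z := Z) (A := W) (B := C) (slope Z (PersSub.quot U W))
      (slope Z (PersSub.quot W C))
    have h7 := mul_nonneg (sub_nonneg.2 hle) (sub_nonneg.2 hre.le)
    have h8 := mul_neg_of_neg_of_pos (sub_neg.2 hlt)
      (sub_pos.2 (re_val_lt (Z := Z) hFP (hG hU) (hG hC) hCt.2))
    linarith

theorem exists_iterate_until {α : Type*} {P : α → Prop} (b : α) {next : α → α}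
    (h : ∀ x, P x → x ≠ b → P (next x)) {a : α} (ha : P a) :
    ∃ U : ℕ → α, U 0 = a ∧ (∀ k, U k ≠ b → U (k + 1) = next (U k)) ∧ ∀ k, P (U k) := by
  classical
  let step : {x // P x} → {x // P x} := fun x =>
    if hx : x.1 = b then x else ⟨next x.1, h x.1 x.2 hx⟩
  refine ⟨fun k => (step^[k] ⟨a, ha⟩).1, rfl, fun k hk => ?_, fun k => (step^[k] ⟨a, ha⟩).2⟩
  dsimp only
  rw [Function.iterate_succ_apply']
  exact congrArg Subtype.val (dif_neg hk)

/-- Existence of the Harder-Narasimhan filtration: iterating the choice of the next step gives a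
chain which terminates because `Re Z` takes finitely many values on discretised submodules. -/
theorem exists_isHNFiltration (hZ : Z.IsDimInvariant) (hV : IsGridded S V)
    (hS : IsDiscretisable Z V S) : ∃ F, IsHNFiltration Z V F := by
  classical
  have hFP := isFP_iff_exists_isGridded.2 ⟨S, hV⟩
  have hG : ∀ {A : PersSub V}, A.IsGridded S → IsFP A.toPers := fun hA =>
    (PersSub.isFP_toPers_iff hFP).2 ⟨S, hV, hA⟩
  have hnext' : ∀ U : PersSub V, U.IsGridded S → U ≠ ⊤ → _ :=
    fun U hU hne => exists_next_step hZ hV hS hU hne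
  choose! next hnext hlt hmax hslope using hnext'
  obtain ⟨U, hU0, hUs, hUg⟩ := exists_iterate_until (⊤ : PersSub V) hnext (PersSub.isGridded_bot S)
  have hstep : ∀ k, U k ≠ ⊤ → U k < U (k + 1) := fun k hk => by
    rw [hUs k hk]
    exact hlt _ (hUg k) hk
  have hex : ∃ k, U k = ⊤ := by
    by_contra! hne
    have hm : StrictMono fun k => (Z.val (U k).toPers).re := strictMono_nat_of_lt_succ fun k =>
      re_val_lt hFP (hG (hUg k)) (hG (hUg (k + 1))) (hstep k (hne k))
    refine Set.infinite_range_of_injective hm.injective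
      (((finite_val_gridded (Z := Z) hZ hV).image Complex.re).subset ?_)
    rintro _ ⟨k, rfl⟩
    exact ⟨_, ⟨U k, hUg k, rfl⟩, rfl⟩
  let N := Nat.find hex
  have hne : ∀ k, k < N → U k ≠ ⊤ := fun k hk => Nat.find_min hex hk
  let F : LTSeries (PersSub V) := ⟨N, fun i => U i, fun i => hstep i (hne i i.2)⟩
  have hgr : ∀ j : Fin N, gr F j = PersSub.quot (U j) (next (U j)) := fun j => by
    rw [← hUs j (hne j j.2)]
    rfl
  have hanti : ∀ k, k + 1 < N → slope Z (PersSub.quot (U (k + 1)) (next (U (k + 1)))) <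
      slope Z (PersSub.quot (U k) (next (U k))) := by
    intro k hk
    have hk0 := hne k (by omega)
    have hk1 := hne (k + 1) hk
    have h1 := hslope (U k) (hUg k) hk0 (next (U (k + 1))) (hnext _ (hUg (k + 1)) hk1)
    rw [← hUs k hk0] at h1 ⊢
    exact h1 (hlt _ (hUg (k + 1)) hk1)
  have hN : U N = ⊤ := Nat.find_spec hex
  refine ⟨F, hU0, hN, fun i => hG (hUg i), fun j => ?_, ?_⟩
  · have hj := hne j j.2
    rw [hgr j]
    exact (isSemistable_quot_iff hZ hFP (hG (hUg j)) (hG (hnext _ (hUg j) hj))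
      (hlt _ (hUg j) hj)).2 fun C hC hUC _ => hmax _ (hUg j) hj C hC hUC
  · have : ∀ (m k : ℕ), k + m + 1 < N →
        slope Z (PersSub.quot (U (k + m + 1)) (next (U (k + m + 1)))) <
          slope Z (PersSub.quot (U k) (next (U k))) := by
      intro m
      induction m with
      | zero => exact fun k hk => hanti k hk
      | succ m ih => exact fun k hk => (hanti (k + m + 1) hk).trans (ih k (by omega))
    intro i j hij
    change slope Z (gr F j) < slope Z (gr F i)
    rw [hgr, hgr]
    obtain ⟨m, hm⟩ := Nat.exists_eq_add_of_lt (Fin.lt_def.1 hij)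
    rw [hm]
    exact this m i (hm ▸ j.2)

end Existence

/-! ### Functoriality of the Harder-Narasimhan parts -/

section Functoriality

variable {K : Type u} [Field K]

theorem finrank_map_add_finrank_inf_ker {M N : Type*} [AddCommGroup M] [Module K M]
    [AddCommGroup N] [Module K N] [Module.Finite K M] (f : M →ₗ[K] N) (A : Submodule K M) :
    Module.finrank K (A.map f) + Module.finrank K ((A ⊓ LinearMap.ker f : Submodule K M)) =
      Module.finrank K A := by
  have h := LinearMap.finrank_range_add_finrank_ker (f.domRestrict A)
  rw [LinearMap.range_domRestrict] at h
  rw [← h, ← Submodule.map_comap_subtype]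
  congr 1
  exact (Submodule.equivMapOfInjective _ A.injective_subtype _).finrank_eq.symm

variable {n : ℕ} {T : Type} [LinearOrder T] {V W : Pers K (Fin n → T)}
  {Z : StabilityCondition K (Fin n → T)}

/-- Morphisms send the part of slope at least `θ` into the part of slope at least `θ`. The reason
is that the quotient of `φ(A)` by `φ(A) ⊓ B` is also that of `A` by `A ⊓ φ⁻¹(B)`. -/
theorem IsLargestMaximiser.map_le (hZ : Z.IsDimInvariant) (hV : IsFP V) (hW : IsFP W)
    (φ : V ⟶ W) {θ : ℝ} {A : PersSub V} {B : PersSub W} (hA : IsLargestMaximiser Z θ A)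
    (hB : IsLargestMaximiser Z θ B) : A.map φ ≤ B := by
  have hφA := PersSub.isFP_map φ hV hW hA.1
  have hI := PersSub.isFP_inf hW hφA hB.1
  have hC := PersSub.isFP_inf hV hA.1 (PersSub.isFP_comap φ hV hW hB.1)
  have hval : Z.val (PersSub.quot (A ⊓ B.comap φ) A) =
      Z.val (PersSub.quot (A.map φ ⊓ B) (A.map φ)) := by
    refine hZ _ _ (PersSub.isFP_quot hV hC hA.1) (PersSub.isFP_quot hW hI hφA)
      (funext fun q => ?_)
    have := hV.finite q
    have := hW.finite q
    have h1 := finrank_quot_add (inf_le_left : A ⊓ B.comap φ ≤ A) q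
    have h2 := finrank_quot_add (inf_le_left : A.map φ ⊓ B ≤ A.map φ) q
    have h3 := finrank_map_add_finrank_inf_ker (φ.app q).hom (A.space q)
    have h4 := finrank_map_add_finrank_inf_ker (φ.app q).hom ((A ⊓ B.comap φ).space q)
    have h5 : ((A ⊓ B.comap φ).space q).map (φ.app q).hom = (A.map φ ⊓ B).space q := by
      ext y
      constructor
      · rintro ⟨x, ⟨hx, hx'⟩, rfl⟩
        exact ⟨⟨x, hx, rfl⟩, hx'⟩
      · rintro ⟨⟨x, hx, rfl⟩, hx'⟩
        exact ⟨x, ⟨hx, hx'⟩, rfl⟩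
    have h6 : (A ⊓ B.comap φ).space q ⊓ LinearMap.ker (φ.app q).hom =
        A.space q ⊓ LinearMap.ker (φ.app q).hom := by
      ext x
      refine ⟨fun h => ⟨h.1.1, h.2⟩, fun h => ⟨⟨h.1, ?_⟩, h.2⟩⟩
      change (φ.app q).hom x ∈ B.space q
      rw [LinearMap.mem_ker.1 h.2]
      exact zero_mem _
    rw [h5, h6] at h4
    change Module.finrank K ((A.map φ).space q) + _ = _ at h3
    omega
  have h1 := level_eq_level_add (Z := Z) θ hV hC hA.1 inf_le_left
  have h2 := level_eq_level_add (Z := Z) θ hW hI hφA inf_le_left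
  have h3 := level_sup_add_level_inf hZ hW θ hφA hB.1
  have h4 := (hA.2 _ hC).1
  have h5 := hB.2 _ (PersSub.isFP_sup hW hφA hB.1)
  rw [hval] at h1
  exact le_sup_left.trans (h5.2 (by linarith [h5.1]))

theorem rank_toPers_map {Q : Type} [PartialOrder Q] {V : Pers K Q} (A : PersSub V) {p q : Q}
    (m : p ⟶ q) : LinearMap.rank (A.toPers.map m).hom =
      Module.rank K ((A.space p).map (V.map m).hom) := by
  let f : A.space p →ₗ[K] A.space q := (V.map m).hom.restrict (A.map_le m)
  have h : (A.space p).map (V.map m).hom =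
      (LinearMap.range f).map (A.space q).subtype := by
    ext x
    constructor
    · rintro ⟨y, hy, rfl⟩
      exact ⟨⟨_, A.map_le m hy⟩, ⟨⟨y, hy⟩, rfl⟩, rfl⟩
    · rintro ⟨_, ⟨y, rfl⟩, rfl⟩
      exact ⟨y.1, y.2, rfl⟩
  rw [h]
  change Module.rank K (LinearMap.range f) = _
  exact (Submodule.equivMapOfInjective _ (A.space q).injective_subtype _).rank_eq

end Functoriality

/-! ### Stability of the filtered rank invariant -/

section Stability

variable {K : Type u} [Field K] {n : ℕ} {T : Type} [AddCommGroup T] [LinearOrder T]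
  [IsOrderedAddMonoid T] {V W : Pers K (Fin n → T)} {Z : StabilityCondition K (Fin n → T)}

theorem IsFP.shift (hV : IsFP V) (x : Fin n → T) : IsFP (shift x V) := by
  classical
  obtain ⟨S, hS⟩ := isFP_iff_exists_isGridded.1 hV
  refine isFP_iff_exists_isGridded.2 ⟨Finset.univ.biUnion fun i => S.image (· - x i), ?_⟩
  have hmem : ∀ i, ∀ s ∈ S, s - x i ∈ Finset.univ.biUnion fun i => S.image (· - x i) :=
    fun i s hs => Finset.mem_biUnion.2 ⟨i, Finset.mem_univ _, Finset.mem_image_of_mem _ hs⟩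
  refine ⟨fun q => hS.finite (x + q), fun q ⟨i, hi⟩ => hS.subsingleton (x + q)
    ⟨i, fun s hs h => hi _ (hmem i s hs) (sub_le_iff_le_add'.2 h)⟩, fun p q h hpq => ?_⟩
  refine hS.bijective (x + p) (x + q) _ fun i s hs => ?_
  have := hpq i _ (hmem i s hs)
  rwa [sub_le_iff_le_add', sub_le_iff_le_add'] at this

/-- The comparison of ranks behind functoriality and stability: a morphism `φ` between shifts
preserves the Harder-Narasimhan parts, so an internal map of `V` which factors through `φ` and an
internal map of `W` has at most the rank of the latter on these parts. -/
theorem hnRank_le_hnRank (hZ : Z.IsDimInvariant)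
    (hE : ∀ U : Pers K (Fin n → T), IsFP U → ∃ F, IsHNFiltration Z U F)
    (hV : IsFP V) (hW : IsFP W) (θ : ℝ) {x y x' y' : Fin n → T} (h : x ≤ y) (h' : x' ≤ y')
    (φ : shift x' V ⟶ shift x W) (ψ : W.obj (x + (y - x)) →ₗ[K] V.obj (x' + (y' - x')))
    (hφψ : ∀ v, ψ (((shift x W).map (homOfLE (sub_nonneg.2 h))).hom ((φ.app 0).hom v)) =
      ((shift x' V).map (homOfLE (sub_nonneg.2 h'))).hom v) :
    hnRank Z V θ x' y' ≤ hnRank Z W θ x y := by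
  rw [hnRank, hnRank, dif_pos h, dif_pos h', rank_toPers_map, rank_toPers_map]
  refine Cardinal.toENat.monotone' ?_
  refine (Submodule.rank_mono ?_).trans (rank_map_le ψ
    (((hnPart Z θ (shift x W)).space 0).map ((shift x W).map (homOfLE (sub_nonneg.2 h))).hom))
  rintro _ ⟨v, hv, rfl⟩
  have hle := IsLargestMaximiser.map_le hZ (hV.shift x') (hW.shift x) φ
    (hnPart_isLargestMaximiser hZ (hV.shift x') (hE _ (hV.shift x')) θ)
    (hnPart_isLargestMaximiser hZ (hW.shift x) (hE _ (hW.shift x)) θ)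
  refine ⟨_, ⟨(φ.app 0).hom v, hle 0 ⟨v, hv, rfl⟩, rfl⟩, hφψ v⟩

theorem hnRank_mono (hZ : Z.IsDimInvariant)
    (hE : ∀ U : Pers K (Fin n → T), IsFP U → ∃ F, IsHNFiltration Z U F)
    (hV : IsFP V) (θ : ℝ) {x y x' y' : Fin n → T} (hx : x' ≤ x) (hy : y ≤ y') :
    hnRank Z V θ x' y' ≤ hnRank Z V θ x y := by
  by_cases h : x ≤ y
  · have h' := (hx.trans h).trans hy
    let φ : shift x' V ⟶ shift x V :=
      { app := fun q => V.map (homOfLE (add_le_add_left hx q))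
        naturality := fun p q f => ModuleCat.hom_ext (LinearMap.ext fun v =>
          (map_apply_map V _ _ (homOfLE (add_le_add hx (leOfHom f))) v).trans
            (map_apply_map V _ _ _ v).symm) }
    have hle : x + (y - x) ≤ x' + (y' - x') := by
      rw [add_sub_cancel, add_sub_cancel]
      exact hy
    refine hnRank_le_hnRank hZ hE hV hV θ h h' φ (V.map (homOfLE hle)).hom fun v => ?_
    have h1 : x' + 0 ≤ x + (y - x) := add_le_add hx (sub_nonneg.2 h)
    exact (congrArg _ (map_apply_map V _ _ (homOfLE h1) v)).trans (map_apply_map V _ _ _ v)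
  · rw [hnRank, hnRank, dif_neg h]
    exact le_top

theorem isFunctorial_of_mono {Q : Type} [AddCommGroup Q] [PartialOrder Q] {s : Q → Q → ℕ∞}
    (hs : ∀ {x y x' y' : Q}, x' ≤ x → y ≤ y' → s x' y' ≤ s x y) : IsFunctorial s :=
  ⟨{ obj := fun p => Opposite.op (s p.1.unop p.2)
     map := fun f => (homOfLE (hs (leOfHom f.1.unop) (leOfHom f.2))).op
     map_id := fun _ => Quiver.Hom.unop_inj (Subsingleton.elim _ _)
     map_comp := fun _ _ => Quiver.Hom.unop_inj (Subsingleton.elim _ _) }, fun _ _ => rfl⟩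

theorem hnRank_le_of_interleaved (hZ : Z.IsDimInvariant)
    (hE : ∀ U : Pers K (Fin n → T), IsFP U → ∃ F, IsHNFiltration Z U F)
    (hV : IsFP V) (hW : IsFP W) (θ : ℝ) {e : Fin n → T} (he : 0 ≤ e) (f : V ⟶ shift e W)
    (g : W ⟶ shift e V) (h : ∀ q, q ≤ e + (e + q))
    (hfg : ∀ q, f.app q ≫ g.app (e + q) = V.map (homOfLE (h q))) (a b : Fin n → T) :
    hnRank Z V θ (a - e) (b + e) ≤ hnRank Z W θ a b := by
  by_cases hab : a ≤ b
  · have h' : a - e ≤ b + e :=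
      (sub_le_self a he).trans (hab.trans (le_add_of_nonneg_right he))
    have heq : ∀ q, e + (a - e + q) ≤ a + q := fun q => by
      rw [← add_assoc, add_sub_cancel]
    let φ : shift (a - e) V ⟶ shift a W :=
      { app := fun q => f.app (a - e + q) ≫ W.map (homOfLE (heq q))
        naturality := fun p q m => by
          refine ModuleCat.hom_ext (LinearMap.ext fun v => ?_)
          have hpq : a - e + p ≤ a - e + q := add_le_add_right (leOfHom m) _
          have hpq' : e + (a - e + p) ≤ a + q := (heq p).trans (add_le_add_right (leOfHom m) _)
          refine Eq.trans ?_ (map_apply_map W (homOfLE (heq p)) _ (homOfLE hpq')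
            ((f.app (a - e + p)).hom v)).symm
          exact (congrArg _ (apply_naturality f (homOfLE hpq) v)).trans
            (map_apply_map W _ _ _ _) }
    have hle : e + (a + (b - a)) ≤ a - e + (b + e - (a - e)) := by
      rw [add_sub_cancel, add_sub_cancel, add_comm]
    refine hnRank_le_hnRank hZ hE hV hW θ hab h' φ
      ((V.map (homOfLE hle)).hom ∘ₗ (g.app (a + (b - a))).hom) fun v => ?_
    have h1 : e + (a - e + 0) ≤ a + (b - a) := (heq 0).trans
      (add_le_add_right (sub_nonneg.2 hab) _)
    have h2 : ((shift a W).map (homOfLE (sub_nonneg.2 hab))).hom ((φ.app 0).hom v) =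
        (W.map (homOfLE h1)).hom ((f.app (a - e + 0)).hom v) := map_apply_map W _ _ _ _
    have h3 : (g.app (e + (a - e + 0))).hom ((f.app (a - e + 0)).hom v) =
        (V.map (homOfLE (h (a - e + 0)))).hom v :=
      congrArg (fun t => t.hom v) (hfg (a - e + 0))
    rw [h2]
    refine (congrArg (V.map (homOfLE hle)).hom
      ((apply_naturality g (homOfLE h1) _).trans (congrArg _ h3))).trans ?_
    have h4 : a - e + 0 ≤ e + (a + (b - a)) := (h _).trans (add_le_add_right h1 _)
    exact (congrArg _ (map_apply_map V _ _ (homOfLE h4) v)).trans (map_apply_map V _ _ _ v)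
  · rw [hnRank, hnRank, dif_neg hab]
    exact le_top

/-- Stability of the filtered rank invariant, for any stability condition along which
Harder-Narasimhan filtrations exist. -/
theorem erosionDist_hnRank_le [ENorm T] (hZ : Z.IsDimInvariant)
    (hE : ∀ U : Pers K (Fin n → T), IsFP U → ∃ F, IsHNFiltration Z U F)
    (hV : IsFP V) (hW : IsFP W) (θ : ℝ) :
    erosionDist (hnRank Z V θ) (hnRank Z W θ) ≤ interleavingDist V W := by
  refine iInf_mono fun ε => iInf_mono fun hε => le_iInf fun ⟨f, g, h, hfg, hgf⟩ => ?_
  have hε' : (0 : Fin n → T) ≤ fun _ => ε := fun _ => hε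
  exact iInf_le_of_le (fun a b => ⟨hnRank_le_of_interleaved hZ hE hV hW θ hε' f g h hfg a b,
    hnRank_le_of_interleaved hZ hE hW hV θ hε' g f h hgf a b⟩) le_rfl

end Stability

/-! ### Functions constant on the cells of a grid -/

section Squash

variable {n : ℕ} {T : Type}

open Classical in
/-- The map `T ^ n → T ^ n` which sends the `i`-th coordinate to `s` if it lies in `I`. -/
def squash (i : Fin n) (I : Set T) (s : T) (q : Fin n → T) : Fin n → T :=
  fun j => if j = i ∧ q j ∈ I then s else q j

theorem squash_of_notMem {i : Fin n} {I : Set T} {s : T} {q : Fin n → T} (h : q i ∉ I) :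
    squash i I s q = q := by
  funext j
  refine if_neg ?_
  rintro ⟨rfl, hj⟩
  exact h hj

theorem squash_of_mem {i : Fin n} {I : Set T} {s : T} {q : Fin n → T} (h : q i ∈ I) :
    squash i I s q = Function.update q i s := by
  funext j
  by_cases hj : j = i
  · subst hj
    rw [Function.update_self]
    exact if_pos ⟨rfl, h⟩
  · rw [Function.update_of_ne hj]
    exact if_neg fun h => hj h.1

end Squash

section CellFunctions

variable {n : ℕ} {T : Type} [LinearOrder T] {S S' : Finset T}

/-- A function which is constant on the cells of the grid `S ^ n`. -/
def IsCellConst (S : Finset T) (d : (Fin n → T) → ℝ) : Prop :=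
  ∀ p q, SameCell S p q → d p = d q

theorem IsCellConst.factorsThrough {d : (Fin n → T) → ℝ} (hd : IsCellConst S d) :
    Function.FactorsThrough d (fun q (i : Fin n) (s : S) => (s : T) ≤ q i) :=
  fun p q h => hd p q fun i s hs =>
    iff_of_eq (congrFun (congrFun h i) (⟨s, hs⟩ : S))

theorem IsCellConst.exists_bound {d : (Fin n → T) → ℝ} (hd : IsCellConst S d) :
    ∃ C, ∀ q, ‖d q‖ ≤ C := by
  have h : (Set.range fun q => ‖d q‖).Finite := by
    refine (Set.finite_range fun c : Fin n → S → Prop => ‖Function.extend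
      (fun q (i : Fin n) (s : S) => (s : T) ≤ q i) d 0 c‖).subset ?_
    rintro _ ⟨q, rfl⟩
    exact ⟨_, congrArg norm (hd.factorsThrough.extend_apply 0 q)⟩
  obtain ⟨C, hC⟩ := h.bddAbove
  exact ⟨C, fun q => hC ⟨q, rfl⟩⟩

theorem IsCellConst.measurable [MeasurableSpace T] [TopologicalSpace T] [OrderClosedTopology T]
    [OpensMeasurableSpace T] {d : (Fin n → T) → ℝ} (hd : IsCellConst S d) : Measurable d := by
  have h : Measurable fun (q : Fin n → T) (i : Fin n) (s : S) => (s : T) ≤ q i :=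
    measurable_pi_iff.2 fun i => measurable_pi_iff.2 fun s => measurableSet_setOfPred.1
      (measurableSet_Ici.preimage (measurable_pi_apply i))
  have h' := (Measurable.of_discrete (f := Function.extend
    (fun (q : Fin n → T) (i : Fin n) (s : S) => (s : T) ≤ q i) d 0)).comp h
  rwa [hd.factorsThrough.extend_comp] at h'

/-- The set of the `u` which are separated from `x` by no element of `S`. -/
def gap (S : Finset T) (x : T) : Set T := {u | ∀ s ∈ S, s ≤ u ↔ s ≤ x}

theorem mem_gap_iff_of_forall {S : Finset T} {x u v : T} (h : ∀ s ∈ S, s ≤ u ↔ s ≤ v) :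
    u ∈ gap S x ↔ v ∈ gap S x :=
  forall₂_congr fun s hs => by rw [h s hs]

theorem gap_eq_Ico {x y : T} (hx : x ∈ S) (hy : y ∈ S) (hxy : x < y)
    (h : ∀ s ∈ S, s < y → s ≤ x) : gap S x = Set.Ico x y := by
  ext u
  constructor
  · exact fun hu => ⟨(hu x hx).2 le_rfl,
      lt_of_not_ge fun hyu => absurd ((hu y hy).1 hyu) (not_le.2 hxy)⟩
  · exact fun hu s hs => ⟨fun hsu => h s hs (hsu.trans_lt hu.2), fun hsx => hsx.trans hu.1⟩

theorem gap_eq_Ici {x : T} (hx : x ∈ S) (h : ∀ s ∈ S, s ≤ x) : gap S x = Set.Ici x := by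
  ext u
  exact ⟨fun hu => (hu x hx).2 le_rfl, fun hu s hs => ⟨fun _ => h s hs, fun hsx => hsx.trans hu⟩⟩

theorem sameCell_squash {i : Fin n} {x s : T} (hs : s ∈ gap S x) (q : Fin n → T) :
    SameCell S (squash i (gap S x) s q) q := by
  intro j r hr
  unfold squash
  split_ifs with h
  · rw [hs r hr, h.2 r hr]
  · rfl

theorem squash_mono {i : Fin n} {x s : T} {p q : Fin n → T} (hpq : p ≤ q)
    (hc : SameCell S p q) : squash i (gap S x) s p ≤ squash i (gap S x) s q := by
  intro j
  have := mem_gap_iff_of_forall (x := x) (hc j)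
  unfold squash
  by_cases h : j = i ∧ p j ∈ gap S x
  · rw [if_pos h, if_pos ⟨h.1, this.1 h.2⟩]
  · rw [if_neg h, if_neg fun h' => h ⟨h'.1, this.2 h'.2⟩]
    exact hpq j

theorem SameCell.squash (hS : S ⊆ S') {i : Fin n} {x s : T} {p q : Fin n → T}
    (hc : SameCell S' p q) :
    SameCell S' (squash i (gap S x) s p) (HNPersistence.squash i (gap S x) s q) := by
  intro j r hr
  have := mem_gap_iff_of_forall (x := x) (hc.mono hS j)
  unfold HNPersistence.squash
  by_cases h : j = i ∧ p j ∈ gap S x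
  · rw [if_pos h, if_pos ⟨h.1, this.1 h.2⟩]
  · rw [if_neg h, if_neg fun h' => h ⟨h'.1, this.2 h'.2⟩]
    exact hc j r hr

/-- The points of `T ^ n` which lie above some point of the grid `S ^ n`. -/
def aboveGrid (S : Finset T) : Set (Fin n → T) := {q | ∀ i, ∃ s ∈ S, s ≤ q i}

theorem SameCell.mem_aboveGrid_iff {p q : Fin n → T} (h : SameCell S p q) :
    p ∈ aboveGrid S ↔ q ∈ aboveGrid S :=
  forall_congr' fun i => exists_congr fun s => and_congr_right fun hs => h i s hs

/-- The properties of the dimension vector of a submodule discretised by the grid `S' ^ n` of a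
module discretised by the coarser grid `S ^ n`: on each cell of the latter it is monotone, since
the internal maps of the ambient module are bijective there. -/
structure IsDimLike (S S' : Finset T) (d : (Fin n → T) → ℝ) : Prop where
  const : IsCellConst S' d
  mono : ∀ p q, p ≤ q → SameCell S p q → d p ≤ d q
  zero : ∀ q, (∃ i, ∀ s ∈ S, ¬ s ≤ q i) → d q = 0

theorem IsDimLike.comp_squash (hS : S ⊆ S') {d : (Fin n → T) → ℝ} (hd : IsDimLike S S' d)
    (i : Fin n) {x s : T} (hs : s ∈ gap S x) : IsDimLike S S' (d ∘ squash i (gap S x) s) where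
  const _ _ h := hd.const _ _ (h.squash hS)
  mono p q hpq h := hd.mono _ _ (squash_mono hpq h)
    ((sameCell_squash hs p).trans (h.trans (sameCell_squash hs q).symm))
  zero q := fun ⟨j, hj⟩ => hd.zero _ ⟨j, fun r hr h => hj r hr ((sameCell_squash hs q j r hr).1 h)⟩

theorem le_comp_squash {d : (Fin n → T) → ℝ} (hd : IsDimLike S S' d) {i : Fin n} {x s : T}
    (hs : s ∈ gap S x) {q : Fin n → T} (h : q i ∈ gap S x → q i ≤ s) :
    d q ≤ d (squash i (gap S x) s q) := by
  refine hd.mono _ _ (fun j => ?_) (sameCell_squash hs q).symm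
  unfold squash
  split_ifs with hj
  · rw [hj.1]
    exact h (hj.1 ▸ hj.2)
  · exact le_rfl

/-- If squashing any single gap to a suitable point does not decrease `Λ`, then all gaps can be
squashed, in all coordinates: this gives monotone maps which preserve the cells of the grid and
are constant on the gaps. -/
theorem exists_squash_all (hS : S ⊆ S') {d : (Fin n → T) → ℝ} (hd : IsDimLike S S' d)
    (Λ : ((Fin n → T) → ℝ) → ℝ)
    (hΛ : ∀ d, IsDimLike S S' d → ∀ i, ∀ x ∈ S, ∃ s ∈ gap S x,
      Λ d ≤ Λ (d ∘ squash i (gap S x) s)) :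
    ∃ t : Fin n → T → T, (∀ i, Monotone (t i)) ∧ (∀ i u, ∀ s ∈ S, s ≤ t i u ↔ s ≤ u) ∧
      (∀ i, ∀ x ∈ S, ∀ u ∈ gap S x, ∀ v ∈ gap S x, t i u = t i v) ∧
      Λ d ≤ Λ (fun q => d fun i => t i (q i)) := by
  classical
  suffices h : ∀ Γ : Finset (Fin n × T), Γ ⊆ Finset.univ ×ˢ S →
      ∃ t : Fin n → T → T, (∀ i, Monotone (t i)) ∧ (∀ i u, ∀ s ∈ S, s ≤ t i u ↔ s ≤ u) ∧
      (∀ a ∈ Γ, ∀ u ∈ gap S a.2, ∀ v ∈ gap S a.2, t a.1 u = t a.1 v) ∧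
      Λ d ≤ Λ (fun q => d fun i => t i (q i)) ∧ IsDimLike S S' fun q => d fun i => t i (q i) by
    obtain ⟨t, h1, h2, h3, h4, -⟩ := h _ le_rfl
    exact ⟨t, h1, h2, fun i x hx => h3 (i, x) (Finset.mem_product.2 ⟨Finset.mem_univ _, hx⟩), h4⟩
  intro Γ
  induction Γ using Finset.induction_on with
  | empty =>
    intro _
    exact ⟨fun _ u => u, fun _ => monotone_id, fun _ _ _ _ => Iff.rfl,
      fun a ha => absurd ha (Finset.notMem_empty a), le_rfl, hd⟩
  | insert a Γ _ ih =>
    intro hΓ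
    obtain ⟨t, h1, h2, h3, h4, h5⟩ := ih fun b hb => hΓ (Finset.mem_insert_of_mem hb)
    obtain ⟨i, x⟩ := a
    have hx : x ∈ S := (Finset.mem_product.1 (hΓ (Finset.mem_insert_self _ _))).2
    obtain ⟨s, hs, h6⟩ := hΛ _ h5 i x hx
    let φ : Fin n → T → T := fun j u => if j = i ∧ u ∈ gap S x then s else u
    have hφ : ∀ j, Monotone (φ j) := by
      intro j u v huv
      by_cases hu : j = i ∧ u ∈ gap S x <;> by_cases hv : j = i ∧ v ∈ gap S x
      · simp only [φ, if_pos hu, if_pos hv, le_refl]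
      · simp only [φ, if_pos hu, if_neg hv]
        have hv' : v ∉ gap S x := fun h => hv ⟨hu.1, h⟩
        by_contra! hlt
        exact hv' fun r hr => ⟨fun hrv => (hs r hr).1 (hrv.trans hlt.le),
          fun hrx => ((hu.2 r hr).2 hrx).trans huv⟩
      · simp only [φ, if_neg hu, if_pos hv]
        have hu' : u ∉ gap S x := fun h => hu ⟨hv.1, h⟩
        by_contra! hlt
        exact hu' fun r hr => ⟨fun hru => (hv.2 r hr).1 (hru.trans huv),
          fun hrx => ((hs r hr).2 hrx).trans hlt.le⟩
      · simp only [φ, if_neg hu, if_neg hv]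
        exact huv
    have hφS : ∀ j u, ∀ r ∈ S, r ≤ φ j u ↔ r ≤ u := by
      intro j u r hr
      simp only [φ]
      split_ifs with h
      · rw [hs r hr, h.2 r hr]
      · rfl
    refine ⟨fun j u => t j (φ j u), fun j => (h1 j).comp (hφ j),
      fun j u r hr => (h2 j _ r hr).trans (hφS j u r hr), fun b hb u hu v hv => ?_, ?_, ?_⟩
    · rcases Finset.mem_insert.1 hb with rfl | hb
      · simp only [φ]
        rw [if_pos ⟨trivial, hu⟩, if_pos ⟨trivial, hv⟩]
      · exact h3 b hb _ ((mem_gap_iff_of_forall (hφS b.1 u)).2 hu) _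
          ((mem_gap_iff_of_forall (hφS b.1 v)).2 hv)
    · exact h4.trans h6
    · exact h5.comp_squash hS i hs

end CellFunctions

/-! ### Averaging over a gap of the grid -/

section Averaging

variable {n : ℕ} {T : Type} [MeasurableSpace T] {μ : Measure T}

/-- The number `L d` is at most the average over `s ∈ I` of the values of `L` at the function `d`
squashed to `s` in the `i`-th coordinate, in a form which passes to sums: up to a constant these
values are at least a function `ℓ` of `s` with a known integral. -/
def AveragesOver (μ : Measure T) (i : Fin n) (I : Set T) (d : (Fin n → T) → ℝ)
    (L : ((Fin n → T) → ℝ) → ℝ) : Prop :=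
  ∃ (C : ℝ) (ℓ : T → ℝ), IntegrableOn ℓ I μ ∧ L d ≤ C + ∫ s in I, ℓ s ∂μ ∧
    ∀ s ∈ I, C + μ.real I * ℓ s ≤ L (d ∘ squash i I s)

variable {i : Fin n} {I : Set T} {d : (Fin n → T) → ℝ}

theorem AveragesOver.of_le {L : ((Fin n → T) → ℝ) → ℝ}
    (h : ∀ s ∈ I, L d ≤ L (d ∘ squash i I s)) : AveragesOver μ i I d L :=
  ⟨L d, fun _ => 0, integrableOn_zero, by simp, fun s hs => by simpa using h s hs⟩

theorem AveragesOver.add {L L' : ((Fin n → T) → ℝ) → ℝ} (h : AveragesOver μ i I d L)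
    (h' : AveragesOver μ i I d L') : AveragesOver μ i I d fun f => L f + L' f := by
  obtain ⟨C, ℓ, h1, h2, h3⟩ := h
  obtain ⟨C', ℓ', h1', h2', h3'⟩ := h'
  refine ⟨C + C', fun s => ℓ s + ℓ' s, h1.add h1', ?_, fun s hs => ?_⟩
  · rw [integral_add h1 h1']
    linarith
  · have := h3 s hs
    have := h3' s hs
    rw [mul_add]
    linarith

theorem AveragesOver.const_mul {L : ((Fin n → T) → ℝ) → ℝ} (h : AveragesOver μ i I d L) {c : ℝ}
    (hc : 0 ≤ c) : AveragesOver μ i I d fun f => c * L f := by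
  obtain ⟨C, ℓ, h1, h2, h3⟩ := h
  refine ⟨c * C, fun s => c * ℓ s, h1.const_mul c, ?_, fun s hs => ?_⟩
  · rw [integral_const_mul, ← mul_add]
    exact mul_le_mul_of_nonneg_left h2 hc
  · have := mul_le_mul_of_nonneg_left (h3 s hs) hc
    linarith

theorem AveragesOver.sum {ι : Type*} {L : ι → ((Fin n → T) → ℝ) → ℝ} (s : Finset ι)
    (h : ∀ c ∈ s, AveragesOver μ i I d (L c)) :
    AveragesOver μ i I d fun f => ∑ c ∈ s, L c f := by
  classical
  induction s using Finset.induction_on with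
  | empty => exact AveragesOver.of_le fun s _ => by simp
  | insert c s hc ih =>
    simp only [Finset.sum_insert hc]
    exact (h c (Finset.mem_insert_self c s)).add
      (ih fun b hb => h b (Finset.mem_insert_of_mem hb))

theorem AveragesOver.exists_le {L : ((Fin n → T) → ℝ) → ℝ} (h : AveragesOver μ i I d L)
    (h0 : μ I ≠ 0) (hI : μ I ≠ ∞) : ∃ s ∈ I, L d ≤ L (d ∘ squash i I s) := by
  obtain ⟨C, ℓ, h1, h2, h3⟩ := h
  obtain ⟨s, hs, h4⟩ := exists_setAverage_le h0 hI h1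
  refine ⟨s, hs, h2.trans (le_trans ?_ (h3 s hs))⟩
  have hpos : 0 < μ.real I := ENNReal.toReal_pos h0 hI
  rw [setAverage_eq, smul_eq_mul, inv_mul_le_iff₀ hpos] at h4
  linarith

theorem insertNth_update {k : ℕ} {T : Type} (i : Fin (k + 1)) (u v : T) (r : Fin k → T) :
    Function.update (i.insertNth (α := fun _ => T) u r) i v =
      i.insertNth (α := fun _ => T) v r := by
  simp

/-- Fubini's theorem for the part of an integral where the `i`-th coordinate lies in `I`. -/
theorem setIntegral_eq_integral_insertNth {k : ℕ} {ρ : Fin (k + 1) → Measure T}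
    [∀ j, SigmaFinite (ρ j)] {i : Fin (k + 1)} (hρ : (ρ i).restrict I = μ.restrict I)
    {F : (Fin (k + 1) → T) → ℝ} (hF : Integrable F (Measure.pi ρ)) :
    IntegrableOn (fun u => ∫ r, F (i.insertNth u r) ∂(Measure.pi fun j => ρ (i.succAbove j))) I μ ∧
    ∫ q in {q | q i ∈ I}, F q ∂(Measure.pi ρ) =
      ∫ u in I, ∫ r, F (i.insertNth u r) ∂(Measure.pi fun j => ρ (i.succAbove j)) ∂μ := by
  let e := MeasurableEquiv.piFinSuccAbove (fun _ : Fin (k + 1) => T) i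
  have he := measurePreserving_piFinSuccAbove ρ i
  let G : T × (Fin k → T) → ℝ := fun z => F (e.symm z)
  have hGF : ∀ q, G (e q) = F q := fun q => congrArg F (e.symm_apply_apply q)
  have hG : Integrable G ((ρ i).prod (Measure.pi fun j => ρ (i.succAbove j))) := by
    refine (he.integrable_comp_emb e.measurableEmbedding).1 ?_
    exact hF.congr (Filter.Eventually.of_forall fun q => (hGF q).symm)
  have hset : {q : Fin (k + 1) → T | q i ∈ I} = e ⁻¹' (I ×ˢ Set.univ) := by
    ext q
    exact ⟨fun h => ⟨h, trivial⟩, fun h => h.1⟩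
  have h1 := he.setIntegral_preimage_emb e.measurableEmbedding G (I ×ˢ Set.univ)
  have h2 := setIntegral_prod G (hG.integrableOn (s := I ×ˢ Set.univ))
  rw [Measure.restrict_univ, hρ] at h2
  constructor
  · have h3 : Integrable G (((ρ i).restrict I).prod (Measure.pi fun j => ρ (i.succAbove j))) := by
      have := hG.integrableOn (s := I ×ˢ Set.univ)
      rwa [IntegrableOn, ← Measure.prod_restrict, Measure.restrict_univ] at this
    rw [hρ] at h3
    have : SFinite (μ.restrict I) := hρ ▸ inferInstance
    exact h3.integral_prod_left
  · rw [hset]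
    refine Eq.trans ?_ (h1.trans h2)
    exact integral_congr_ae (Filter.Eventually.of_forall fun q => (hGF q).symm)

theorem measurable_squash (hI : MeasurableSet I) (i : Fin n) (s : T) :
    Measurable (squash i I s) := by
  classical
  refine measurable_pi_iff.2 fun j => ?_
  unfold squash
  by_cases hj : j = i
  · simp only [hj, true_and]
    exact Measurable.ite (hI.preimage (measurable_pi_apply i)) measurable_const
      (measurable_pi_apply i)
  · simp only [hj, false_and, if_false]
    exact measurable_pi_apply j

/-- Integration against a density which does not depend on the `i`-th coordinate in `I`, with
respect to a product measure which is that of the line in this coordinate. -/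
theorem averagesOver_integral {ρ : Fin n → Measure T} [∀ j, SigmaFinite (ρ j)]
    (hI : MeasurableSet I) (hρ : (ρ i).restrict I = μ.restrict I) {h : (Fin n → T) → ℝ}
    (hh : Integrable h (Measure.pi ρ))
    (hconst : ∀ q, ∀ u ∈ I, ∀ v ∈ I, h (Function.update q i u) = h (Function.update q i v))
    (hd : Measurable d) {B : ℝ} (hB : ∀ q, ‖d q‖ ≤ B) :
    AveragesOver μ i I d fun f => ∫ q, h q * f q ∂(Measure.pi ρ) := by
  obtain _ | k := n
  · exact i.elim0
  rcases I.eq_empty_or_nonempty with rfl | ⟨x, hx⟩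
  · exact AveragesOver.of_le fun s hs => absurd hs (Set.notMem_empty s)
  have hA : MeasurableSet {q : Fin (k + 1) → T | q i ∈ I} :=
    hI.preimage (measurable_pi_apply i)
  have hint : ∀ f : (Fin (k + 1) → T) → ℝ, Measurable f → (∀ q, ‖f q‖ ≤ B) →
      Integrable (fun q => h q * f q) (Measure.pi ρ) := fun f hf hB =>
    hh.mul_bdd hf.aestronglyMeasurable (Filter.Eventually.of_forall hB)
  have hconst' : ∀ u ∈ I, ∀ r : Fin k → T,
      h (i.insertNth (α := fun _ => T) u r) = h (i.insertNth (α := fun _ => T) x r) :=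
    fun u hu r => by
      have := hconst (i.insertNth (α := fun _ => T) u r) u hu x hx
      rwa [insertNth_update, insertNth_update] at this
  have key : ∀ f : (Fin (k + 1) → T) → ℝ, Integrable (fun q => h q * f q) (Measure.pi ρ) →
      IntegrableOn (fun u => ∫ r, h (i.insertNth x r) * f (i.insertNth u r)
        ∂(Measure.pi fun j => ρ (i.succAbove j))) I μ ∧
      ∫ q in {q | q i ∈ I}, h q * f q ∂(Measure.pi ρ) =
        ∫ u in I, ∫ r, h (i.insertNth x r) * f (i.insertNth u r)
          ∂(Measure.pi fun j => ρ (i.succAbove j)) ∂μ := by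
    intro f hf
    obtain ⟨h1, h2⟩ := setIntegral_eq_integral_insertNth hρ hf
    have h3 : ∀ u ∈ I, ∫ r, h (i.insertNth u r) * f (i.insertNth u r)
        ∂(Measure.pi fun j => ρ (i.succAbove j)) = ∫ r, h (i.insertNth x r) * f (i.insertNth u r)
        ∂(Measure.pi fun j => ρ (i.succAbove j)) := fun u hu => by simp_rw [hconst' u hu]
    exact ⟨h1.congr_fun h3 hI, h2.trans (setIntegral_congr_fun hI h3)⟩
  have hdi := hint d hd hB
  refine ⟨∫ q in {q | q i ∈ I}ᶜ, h q * d q ∂(Measure.pi ρ), fun u =>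
    ∫ r, h (i.insertNth x r) * d (i.insertNth u r) ∂(Measure.pi fun j => ρ (i.succAbove j)),
    (key d hdi).1, ?_, fun s hs => ?_⟩
  · dsimp only
    rw [← (key d hdi).2, ← integral_add_compl hA hdi, add_comm]
  · have hsi := hint (d ∘ squash i I s) (hd.comp (measurable_squash hI i s)) fun q => hB _
    refine le_of_eq ?_
    dsimp only
    rw [← integral_add_compl hA hsi, (key _ hsi).2, add_comm]
    congr 1
    · rw [← smul_eq_mul, ← setIntegral_const]
      refine setIntegral_congr_fun hI fun u hu => ?_
      refine integral_congr_ae (Filter.Eventually.of_forall fun r => ?_)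
      simp only [Function.comp_apply]
      rw [squash_of_mem (by simpa using hu), insertNth_update]
    · refine setIntegral_congr_fun hA.compl fun q hq => ?_
      simp only [Function.comp_apply]
      rw [squash_of_notMem (I := I) hq]

end Averaging

/-! ### Pulling back submodules along maps which preserve cells -/

section Pullback

variable {K : Type u} [Field K] {n : ℕ} {T : Type} [LinearOrder T] {S : Finset T}
  {V : Pers K (Fin n → T)}

/-- The pullback of a submodule `W` of `V` along a monotone map `ψ` which preserves the cells of
a grid that discretises `V`. Its value at `q` is that of `W` at `ψ q`, transported to `V_q`
through `V_{q ⊓ ψ q}`. -/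
def PersSub.pullback (W : PersSub V) {ψ : (Fin n → T) → (Fin n → T)} (hψ : Monotone ψ) :
    PersSub V where
  space q := ((W.space (ψ q)).comap (V.map (homOfLE (inf_le_right : q ⊓ ψ q ≤ ψ q))).hom).map
    (V.map (homOfLE (inf_le_left : q ⊓ ψ q ≤ q))).hom
  map_le := by
    rintro p q h _ ⟨v, hv, rfl⟩
    have hpq : p ≤ q := leOfHom h
    have hle : p ⊓ ψ p ≤ q ⊓ ψ q := inf_le_inf hpq (hψ hpq)
    refine ⟨(V.map (homOfLE hle)).hom v, ?_, ?_⟩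
    · change (V.map _).hom _ ∈ W.space (ψ q)
      have h1 := W.map_le (homOfLE (hψ hpq)) hv
      change (V.map _).hom ((V.map _).hom v) ∈ W.space (ψ q) at h1
      rw [map_apply_map V _ _ (homOfLE (inf_le_right.trans (hψ hpq)))] at h1
      rwa [map_apply_map V _ _ (homOfLE (inf_le_right.trans (hψ hpq)))]
    · rw [map_apply_map V _ _ (homOfLE (inf_le_left.trans hpq)),
        map_apply_map V _ _ (homOfLE (inf_le_left.trans hpq))]

variable {W U : PersSub V} {ψ : (Fin n → T) → (Fin n → T)} (hψ : Monotone ψ)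

theorem PersSub.finrank_pullback (hV : HNPersistence.IsGridded S V)
    (hc : ∀ q, SameCell S (ψ q) q) (q : Fin n → T) :
    Module.finrank K ((W.pullback hψ).space q) = Module.finrank K (W.space (ψ q)) := by
  have hc1 : SameCell S (q ⊓ ψ q) (ψ q) := (hc q).symm.inf
  have h1 := hV.bijective _ _ (homOfLE (inf_le_left : q ⊓ ψ q ≤ q)) (hc1.trans (hc q))
  have h2 := hV.bijective _ _ (homOfLE (inf_le_right : q ⊓ ψ q ≤ ψ q)) hc1
  refine (Submodule.equivMapOfInjective _ h1.1 _).finrank_eq.symm.trans ?_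
  refine (Submodule.equivMapOfInjective _ h2.1 _).finrank_eq.trans ?_
  rw [Submodule.map_comap_eq_of_surjective h2.2]

theorem PersSub.isGridded_pullback (hV : HNPersistence.IsGridded S V)
    (hc : ∀ q, SameCell S (ψ q) q)
    (hconst : ∀ p q, SameCell S p q → (∀ i, ∃ s ∈ S, s ≤ q i) → ψ p = ψ q) :
    (W.pullback hψ).IsGridded S := by
  rintro p q h hpq x hx
  by_cases hq : ∃ i, ∀ s ∈ S, ¬ s ≤ q i
  · have := hV.subsingleton q hq
    exact ⟨0, zero_mem _, Subsingleton.elim _ _⟩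
  push Not at hq
  obtain ⟨v, hv, rfl⟩ := hx
  have hle : p ⊓ ψ p ≤ q ⊓ ψ q := inf_le_inf (leOfHom h) (hψ (leOfHom h))
  have hcell : ∀ q, SameCell S (q ⊓ ψ q) q := fun q => ((hc q).symm.inf).trans (hc q)
  obtain ⟨v, rfl⟩ := (hV.bijective _ _ (homOfLE hle)
    ((hcell p).trans (hpq.trans (hcell q).symm))).2 v
  have hle' : p ⊓ ψ p ≤ q := inf_le_left.trans (leOfHom h)
  refine ⟨(V.map (homOfLE inf_le_left)).hom v, ⟨v, ?_, rfl⟩, ?_⟩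
  · change (V.map _).hom _ ∈ W.space (ψ q) at hv
    rw [map_apply_map V _ _ (homOfLE (hle.trans inf_le_right))] at hv
    have key : ∀ z, z = ψ q → ∀ k : p ⊓ ψ p ⟶ z, (V.map k).hom v ∈ W.space z := by
      rintro _ rfl k
      exact hv
    exact key _ (hconst p q hpq hq) _
  · rw [map_apply_map V _ _ (homOfLE hle'), map_apply_map V _ _ (homOfLE hle')]

theorem PersSub.le_pullback (hc : ∀ q, SameCell S (ψ q) q) (hU : U.IsGridded S) (hUW : U ≤ W) :
    U ≤ W.pullback hψ := by
  intro q x hx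
  obtain ⟨u, hu, rfl⟩ := hU _ _ (homOfLE (inf_le_left : q ⊓ ψ q ≤ q))
    (((hc q).symm.inf).trans (hc q)) hx
  exact ⟨u, hUW _ (U.map_le _ hu), rfl⟩

end Pullback

/-! ### Grid functions -/

section GridFunctions

variable {n : ℕ} {T : Type} [LinearOrder T]

namespace GridFunction

variable (G : GridFunction n T)

theorem exists_upper_index (i : Fin n) (M : T) :
    ∃ b : ℤ, ∀ t : G.dom i, G.coord i t < M → t.1 ≤ b := by
  by_cases h : BddAbove (G.dom i)
  · obtain ⟨b, hb⟩ := h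
    exact ⟨b, fun t _ => hb t.2⟩
  · have hne : Nonempty (G.dom i) := by
      by_contra hne
      exact h ⟨0, fun t ht => absurd ⟨t, ht⟩ hne⟩
    obtain ⟨t₁, ht₁⟩ := ((G.tendsto_top i h).eventually_ge_atTop M).exists_forall_of_atTop
    exact ⟨t₁, fun t ht => le_of_not_ge fun hlt => absurd (ht₁ t hlt) (not_le.2 ht)⟩

theorem exists_lower_index [NoMinOrder T] (i : Fin n) (m : T) :
    ∃ b : ℤ, ∀ t : G.dom i, m ≤ G.coord i t → b ≤ t.1 := by
  by_cases h : BddBelow (G.dom i)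
  · obtain ⟨b, hb⟩ := h
    exact ⟨b, fun t _ => hb t.2⟩
  · have hne : Nonempty (G.dom i) := by
      by_contra hne
      exact h ⟨0, fun t ht => absurd ⟨t, ht⟩ hne⟩
    obtain ⟨m', hm'⟩ := exists_lt m
    obtain ⟨t₁, ht₁⟩ := ((G.tendsto_bot i h).eventually_le_atBot m').exists_forall_of_atBot
    exact ⟨t₁, fun t ht => le_of_not_ge fun hlt =>
      absurd ((ht₁ t hlt).trans_lt hm') (not_lt.2 ht)⟩

theorem finite_coord [NoMinOrder T] (i : Fin n) (m M : T) :
    (G.coord i '' {t | m ≤ G.coord i t ∧ G.coord i t < M}).Finite := by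
  obtain ⟨b, hb⟩ := G.exists_lower_index i m
  obtain ⟨b', hb'⟩ := G.exists_upper_index i M
  refine Set.Finite.image _ (((Set.finite_Icc b b').preimage
    Subtype.val_injective.injOn).subset fun t ht => ⟨hb t ht.1, hb' t ht.2⟩)

/-- Every point lies in a fibre of the floor function. -/
theorem exists_cell [NoMaxOrder T] (q : Fin n → T) : q ∈ G.cellBot ∨ ∃ p, q ∈ G.cell p := by
  by_cases h : q ∈ G.cellBot
  · exact Or.inl h
  right
  simp only [cellBot, Set.mem_ofPred_eq, not_forall, not_not] at h
  obtain ⟨p₀, hp₀⟩ := h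
  have : ∀ i, ∃ t : G.dom i, G.coord i t ≤ q i ∧ ∀ t' : G.dom i, G.coord i t' ≤ q i → t' ≤ t := by
    intro i
    obtain ⟨M, hM⟩ := exists_gt (q i)
    obtain ⟨b, hb⟩ := G.exists_upper_index i M
    obtain ⟨z, ⟨hz, hzq⟩, hmax⟩ := Int.exists_greatest_of_bdd
      (P := fun z => ∃ h : z ∈ G.dom i, G.coord i ⟨z, h⟩ ≤ q i)
      ⟨b, fun z ⟨hz, hzq⟩ => hb ⟨z, hz⟩ (hzq.trans_lt hM)⟩ ⟨_, (p₀ i).2, hp₀ i⟩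
    exact ⟨⟨z, hz⟩, hzq, fun t' ht' => hmax t'.1 ⟨t'.2, ht'⟩⟩
  choose p hp hmax using this
  exact ⟨p, hp, fun p' hp' i => hmax i (p' i) (hp' i)⟩

variable {G}

/-- A discretisable function takes the same value at two points above the same grid points. -/
theorem Discretises.congr [NoMaxOrder T] {f : (Fin n → T) → ℝ} (hf : G.Discretises f)
    {q q' : Fin n → T} (h : ∀ p, G.toFun p ≤ q ↔ G.toFun p ≤ q') : f q = f q' := by
  obtain ⟨a, ha, h0⟩ := hf
  rcases G.exists_cell q with hq | ⟨p, hp⟩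
  · rw [h0 q hq, h0 q' fun p hp => hq p ((h p).2 hp)]
  · have hp' : q' ∈ G.cell p :=
      ⟨(h p).1 hp.1, fun r hr => hp.2 ((h r).2 hr)⟩
    rw [ha p q hp, ha p q' hp']

/-- A function which vanishes on the unbounded fibres of the floor function of `G` vanishes
beyond all grid points. -/
theorem eq_zero_of_forall_le [NoMaxOrder T] [NoMinOrder T] {a : (Fin n → T) → ℝ}
    (ha : ∀ p, ¬ IsBoundedBox (G.cell p) → ∀ q ∈ G.cell p, a q = 0)
    (ha' : ¬ IsBoundedBox G.cellBot → ∀ q ∈ G.cellBot, a q = 0) {q : Fin n → T} {i : Fin n}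
    (hq : ∀ p, G.toFun p i ≤ q i) : a q = 0 := by
  rcases G.exists_cell q with h | ⟨p, hp⟩
  · refine ha' (fun hb => ?_) q h
    obtain ⟨b, hb⟩ := hb.1
    obtain ⟨u, hu⟩ := exists_lt (min (q i) (b i))
    have hle : Function.update q i u ≤ q :=
      update_le_iff.2 ⟨hu.le.trans (min_le_left _ _), fun _ _ => le_rfl⟩
    have := hb (show Function.update q i u ∈ G.cellBot from fun p hp => h p (hp.trans hle)) i
    rw [Function.update_self] at this
    exact absurd (hu.trans_le (min_le_right _ _)) (not_lt.2 this)
  · refine ha p (fun hb => ?_) q hp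
    obtain ⟨b, hb⟩ := hb.2
    obtain ⟨u, hu⟩ := exists_gt (max (q i) (b i))
    have hle : q ≤ Function.update q i u :=
      le_update_iff.2 ⟨(le_max_left _ _).trans hu.le, fun _ _ => le_rfl⟩
    have hmem : Function.update q i u ∈ G.cell p := by
      refine ⟨hp.1.trans hle, fun r hr => hp.2 fun j => ?_⟩
      by_cases hj : j = i
      · rw [hj]
        exact hq r
      · have := hr j
        rwa [Function.update_of_ne hj] at this
    have := hb hmem i
    rw [Function.update_self] at this
    exact absurd ((le_max_right _ _).trans_lt hu) (not_lt.2 this)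

end GridFunction

/-- A finite grid which refines the one given by `S₀`, and which is adapted to the functions `a`
and `b`: strictly below the last grid point `M` these are constant on cells, also in each
coordinate separately, and beyond `M` the function `a` vanishes. -/
theorem exists_adapted_grid [NoMaxOrder T] [NoMinOrder T] [Nonempty T] {G G' : GridFunction n T}
    [Finite G.Pt] {a b : (Fin n → T) → ℝ} (ha' : G'.Discretises a) (hb : G'.Discretises b)
    (h : ∀ p, ¬ IsBoundedBox (G.cell p) → ∀ q ∈ G.cell p, a q = 0)
    (h' : ¬ IsBoundedBox G.cellBot → ∀ q ∈ G.cellBot, a q = 0) (S₀ : Finset T) :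
    ∃ (S : Finset T) (m M : T), S₀ ⊆ S ∧ m ∈ S ∧ M ∈ S ∧ (∀ s ∈ S, m ≤ s ∧ s ≤ M) ∧
      (∀ s ∈ S₀, s < M) ∧
      (∀ p q, (∀ i, p i = q i ∨ m ≤ p i ∧ p i < M ∧ ∀ s ∈ S, s ≤ p i ↔ s ≤ q i) →
        a p = a q ∧ b p = b q) ∧
      ∀ q i, M ≤ q i → a q = 0 := by
  classical
  have hfin : (Set.range fun x : G.Pt × Fin n => G.toFun x.1 x.2).Finite := Set.finite_range _
  obtain ⟨t₀⟩ := ‹Nonempty T›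
  let S₁ : Finset T := insert t₀ (S₀ ∪ hfin.toFinset)
  have hne : S₁.Nonempty := Finset.insert_nonempty _ _
  let m := S₁.min' hne
  obtain ⟨M, hM⟩ := exists_gt (S₁.max' hne)
  have hlt : ∀ s ∈ S₁, s < M := fun s hs => (S₁.le_max' s hs).trans_lt hM
  have hm : ∀ s ∈ S₁, m ≤ s := fun s hs => S₁.min'_le s hs
  -- The grid points of `G'` between `m` and `M` are finite in number.
  let S : Finset T := insert M (S₁ ∪ Finset.univ.biUnion fun i => (G'.finite_coord i m M).toFinset)
  have hS₁ : S₁ ⊆ S := Finset.subset_union_left.trans (Finset.subset_insert _ _)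
  have hS₀ : S₀ ⊆ S₁ := Finset.subset_union_left.trans (Finset.subset_insert _ _)
  have hmS : m ∈ S := hS₁ (S₁.min'_mem hne)
  have hMS : M ∈ S := Finset.mem_insert_self _ _
  refine ⟨S, m, M, hS₀.trans hS₁, hmS, hMS, fun s hs => ?_, fun s hs => hlt s (hS₀ hs),
    fun p q hpq => ?_, fun q i hq => ?_⟩
  · rcases Finset.mem_insert.1 hs with rfl | hs
    · exact ⟨(hlt _ (S₁.min'_mem hne)).le, le_rfl⟩
    rcases Finset.mem_union.1 hs with hs | hs
    · exact ⟨hm s hs, (hlt s hs).le⟩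
    · obtain ⟨i, -, hi⟩ := Finset.mem_biUnion.1 hs
      obtain ⟨t, ht, rfl⟩ := (Set.Finite.mem_toFinset _).1 hi
      exact ⟨ht.1, ht.2.le⟩
  · have key : ∀ r, G'.toFun r ≤ p ↔ G'.toFun r ≤ q := by
      refine fun r => forall_congr' fun i => ?_
      rcases hpq i with hi | ⟨h1, h2, h3⟩
      · rw [hi]
      rcases lt_or_ge (G'.toFun r i) m with hr | hr
      · exact ⟨fun _ => hr.le.trans ((h3 m hmS).1 h1), fun _ => hr.le.trans h1⟩
      rcases lt_or_ge (G'.toFun r i) M with hr' | hr'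
      · refine h3 _ (Finset.mem_insert_of_mem (Finset.mem_union_right _
          (Finset.mem_biUnion.2 ⟨i, Finset.mem_univ _, (Set.Finite.mem_toFinset _).2
            ⟨r i, ⟨hr, hr'⟩, rfl⟩⟩)))
      · exact ⟨fun hle => absurd (hr'.trans hle) (not_le.2 h2),
          fun hle => absurd ((h3 M hMS).2 (hr'.trans hle)) (not_le.2 h2)⟩
    exact ⟨ha'.congr key, hb.congr key⟩
  · refine GridFunction.eq_zero_of_forall_le h h' (i := i) fun p => le_trans (hlt _ ?_).le hq
    exact Finset.mem_insert_of_mem (Finset.mem_union_right _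
      ((Set.Finite.mem_toFinset _).2 ⟨(p, i), rfl⟩))

end GridFunctions

/-! ### Squashing the gaps does not decrease the level -/

section Squashing

variable {n : ℕ} {T : Type} [LinearOrder T] [MeasurableSpace T] {μ : Measure T}
  {S S' : Finset T} {G : GridFunction n T}

/-- The measure on a face of a bounded cell. -/
abbrev GridFace.measure (μ : Measure T) (c : GridFace G) (i : Fin n) : Measure T :=
  (c.kind i).measure μ (G.toFun c.base i) (c.corner i)

theorem FaceKind.isFiniteMeasure_measure (hμ : ∀ x y, μ (Set.Ico x y) ≠ ∞) (x y : T)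
    (k : FaceKind) : IsFiniteMeasure (k.measure μ x y) := by
  cases k with
  | full => exact ⟨by rw [FaceKind.measure, Measure.restrict_apply_univ]; exact (hμ x y).lt_top⟩
  | lower => exact inferInstanceAs (IsFiniteMeasure (Measure.dirac x))
  | upper => exact inferInstanceAs (IsFiniteMeasure (Measure.dirac y))

theorem GridFace.avg_eq (c : GridFace G) (f : (Fin n → T) → ℝ) :
    c.avg μ f = ((Measure.pi (c.measure μ)).real Set.univ)⁻¹ * ∫ q, f q ∂Measure.pi (c.measure μ) :=
  average_eq _ _

/-- A property of almost all points of the `i`-th factor of a face holds for the `i`-th coordinate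
of almost all points of the face. -/
theorem GridFace.ae_of_ae (hμ : ∀ x y, μ (Set.Ico x y) ≠ ∞) (c : GridFace G) (i : Fin n)
    {P : T → Prop} (h : ∀ᵐ u ∂c.measure μ i, P u) : ∀ᵐ q ∂Measure.pi (c.measure μ), P (q i) := by
  have := fun i => FaceKind.isFiniteMeasure_measure hμ (G.toFun c.base i) (c.corner i) (c.kind i)
  exact Measure.tendsto_eval_ae_ae.eventually h

variable [TopologicalSpace T] [OrderClosedTopology T] [OpensMeasurableSpace T]

theorem GridFace.avg_mono (hμ : ∀ x y, μ (Set.Ico x y) ≠ ∞) (c : GridFace G)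
    {d d' : (Fin n → T) → ℝ} (hd : IsCellConst S d) (hd' : IsCellConst S d')
    (h : ∀ᵐ q ∂Measure.pi (c.measure μ), d q ≤ d' q) : c.avg μ d ≤ c.avg μ d' := by
  have := fun i => FaceKind.isFiniteMeasure_measure hμ (G.toFun c.base i) (c.corner i) (c.kind i)
  have hint : ∀ {d : (Fin n → T) → ℝ}, IsCellConst S d →
      Integrable d (Measure.pi (c.measure μ)) := fun {d} hd => by
    obtain ⟨B, hB⟩ := hd.exists_bound
    exact Integrable.of_bound hd.measurable.aestronglyMeasurable B (Filter.Eventually.of_forall hB)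
  rw [c.avg_eq, c.avg_eq]
  exact mul_le_mul_of_nonneg_left (integral_mono_ae (hint hd) (hint hd') h)
    (inv_nonneg.2 measureReal_nonneg)

/-- The average over a face, as a function of `d`, is at most the average of its values at the
functions obtained by squashing a gap. If the face extends in the direction of the gap, this is an
equality; if the face meets the gap in its first point at most, this is because `d` is monotone on
cells. -/
theorem GridFace.averagesOver_avg (hμ : ∀ x y, μ (Set.Ico x y) ≠ ∞) (hS : S ⊆ S')
    (c : GridFace G) {i : Fin n} (hbase : G.toFun c.base i ∈ S) (hcorner : c.corner i ∈ S)
    {x y : T} (hx : x ∈ S) (hy : y ∈ S) (hxy : x < y) (hnext : ∀ s ∈ S, s < y → s ≤ x)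
    {d : (Fin n → T) → ℝ} (hd : IsDimLike S S' d) :
    AveragesOver μ i (Set.Ico x y) d (c.avg μ) := by
  have hfin := fun i => FaceKind.isFiniteMeasure_measure hμ (G.toFun c.base i) (c.corner i)
    (c.kind i)
  have hgap := gap_eq_Ico hx hy hxy hnext
  by_cases hfull : c.kind i = FaceKind.full ∧ G.toFun c.base i ≤ x ∧ y ≤ c.corner i
  · obtain ⟨B, hB⟩ := hd.const.exists_bound
    have hρ : (c.measure μ i).restrict (Set.Ico x y) = μ.restrict (Set.Ico x y) := by
      rw [GridFace.measure, hfull.1, FaceKind.measure,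
        Measure.restrict_restrict_of_subset (Set.Ico_subset_Ico hfull.2.1 hfull.2.2)]
    have h1 := averagesOver_integral (ρ := c.measure μ) (i := i) measurableSet_Ico hρ
      (h := fun _ => 1) (integrable_const _) (fun _ _ _ _ _ => rfl) hd.const.measurable hB
    simp only [one_mul] at h1
    have h2 := h1.const_mul (c := ((Measure.pi (c.measure μ)).real Set.univ)⁻¹)
      (inv_nonneg.2 measureReal_nonneg)
    simp_rw [← c.avg_eq] at h2
    exact h2
  · refine AveragesOver.of_le fun s hs => ?_
    rw [← hgap] at hs ⊢
    refine c.avg_mono hμ hd.const (hd.comp_squash hS i hs).const ?_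
    have hae : ∀ᵐ u ∂c.measure μ i, u ∈ Set.Ico x y → u = x := by
      have hpt : ∀ z ∈ S, z ∈ Set.Ico x y → z = x :=
        fun z hz hzI => le_antisymm (hnext z hz hzI.2) hzI.1
      rw [GridFace.measure]
      cases hk : c.kind i with
      | full =>
        rw [FaceKind.measure]
        refine (ae_restrict_mem measurableSet_Ico).mono fun u hu huI => ?_
        exfalso
        refine hfull ⟨hk, hnext _ hbase (hu.1.trans_lt huI.2), ?_⟩
        by_contra! hlt
        exact absurd (hnext _ hcorner hlt) (not_le.2 (huI.1.trans_lt hu.2))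
      | lower =>
        rw [FaceKind.measure, ae_dirac_eq]
        exact hpt _ hbase
      | upper =>
        rw [FaceKind.measure, ae_dirac_eq]
        exact hpt _ hcorner
    refine (c.ae_of_ae hμ i hae).mono fun q hq => le_comp_squash hd hs fun hqI => ?_
    rw [hgap] at hqI hs
    rw [hq hqI]
    exact hs.1

/-- Any gap of the grid can be squashed to one of its points without decreasing the functional
given by the density `h` and the faces. For the last gap, on which the sign of `h` is constant,
this point is the first one or one beyond all of `S'`. -/
theorem exists_squash_le [SigmaFinite μ] (hμ : ∀ x y, μ (Set.Ico x y) ≠ ∞)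
    (hμ0 : ∀ x y, x < y → μ (Set.Ico x y) ≠ 0) (hS : S ⊆ S') {M : T} (hM : M ∈ S)
    (hM' : ∀ s ∈ S, s ≤ M) {h : (Fin n → T) → ℝ} (hint : Integrable h (Measure.pi fun _ => μ))
    (hconst : ∀ i, ∀ x ∈ S, x < M → ∀ q, ∀ u ∈ gap S x, ∀ v ∈ gap S x,
      h (Function.update q i u) = h (Function.update q i v))
    (hsign : (∀ q i, M ≤ q i → h q ≤ 0) ∨ ∀ q i, M ≤ q i → 0 ≤ h q) (l : GridFace G →₀ ℝ≥0)
    (hl : ∀ c ∈ l.support, ∀ i, (G.toFun c.base i ∈ S ∧ c.corner i ∈ S) ∧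
      G.toFun c.base i < M ∧ c.corner i < M)
    {d : (Fin n → T) → ℝ} (hd : IsDimLike S S' d) (i : Fin n) {x : T} (hx : x ∈ S) :
    ∃ s ∈ gap S x, (∫ q, h q * d q ∂(Measure.pi fun _ => μ)) + ∑ c ∈ l.support, l c * c.avg μ d ≤
      (∫ q, h q * (d ∘ squash i (gap S x) s) q ∂(Measure.pi fun _ => μ)) +
        ∑ c ∈ l.support, l c * c.avg μ (d ∘ squash i (gap S x) s) := by
  obtain ⟨B, hB⟩ := hd.const.exists_bound
  rcases (hM' x hx).lt_or_eq with hxM | rfl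
  · -- The gap is the interval up to the next grid point.
    classical
    have hne : (S.filter (x < ·)).Nonempty := ⟨M, Finset.mem_filter.2 ⟨hM, hxM⟩⟩
    have hy := Finset.mem_filter.1 (Finset.min'_mem _ hne)
    have hnext : ∀ s ∈ S, s < (S.filter (x < ·)).min' hne → s ≤ x := fun s hs hlt => by
      by_contra! hsx
      exact absurd (Finset.min'_le _ s (Finset.mem_filter.2 ⟨hs, hsx⟩)) (not_le.2 hlt)
    have hgap := gap_eq_Ico hx hy.1 hy.2 hnext
    have hconst' := hconst i x hx hxM
    rw [hgap] at hconst' ⊢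
    exact (AveragesOver.add
      (averagesOver_integral (μ := μ) (ρ := fun _ => μ) measurableSet_Ico rfl hint hconst'
        hd.const.measurable hB)
      (AveragesOver.sum l.support fun c hc => (c.averagesOver_avg hμ hS (hl c hc i).1.1
        (hl c hc i).1.2 hx hy.1 hy.2 hnext hd).const_mul (l c).2)).exists_le
        (hμ0 _ _ hy.2) (hμ _ _)
  · have hgap := gap_eq_Ici hx hM'
    have hmono : ∀ s ∈ gap S x,
        (∀ q, h q * d q ≤ h q * (d ∘ squash i (gap S x) s) q) →
        (∀ c ∈ l.support, c.avg μ d ≤ c.avg μ (d ∘ squash i (gap S x) s)) →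
        (∫ q, h q * d q ∂(Measure.pi fun _ => μ)) + ∑ c ∈ l.support, l c * c.avg μ d ≤
      (∫ q, h q * (d ∘ squash i (gap S x) s) q ∂(Measure.pi fun _ => μ)) +
        ∑ c ∈ l.support, l c * c.avg μ (d ∘ squash i (gap S x) s) := by
      intro s hs h1 h2
      refine add_le_add (integral_mono ?_ ?_ h1) (Finset.sum_le_sum fun c hc =>
        mul_le_mul_of_nonneg_left (h2 c hc) (l c).2)
      · exact hint.mul_bdd hd.const.measurable.aestronglyMeasurable (Eventually.of_forall hB)
      · exact hint.mul_bdd (hd.comp_squash hS i hs).const.measurable.aestronglyMeasurable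
          (Eventually.of_forall fun q => hB _)
    rcases hsign with hsign | hsign
    · have hs : x ∈ gap S x := fun _ _ => Iff.rfl
      refine ⟨x, hs, hmono x hs (fun q => ?_) fun c hc => ?_⟩
      · by_cases hq : q i ∈ gap S x
        · refine mul_le_mul_of_nonpos_left ?_ (hsign q i (hgap.subset hq))
          refine hd.mono _ _ (fun j => ?_) (sameCell_squash hs q)
          unfold squash
          split_ifs with hj
          · have := hj.2
            rw [hgap] at this
            exact this
          · exact le_rfl
        · rw [Function.comp_apply, squash_of_notMem hq]
      · -- Almost all points of a face lie outside the last gap.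
        refine c.avg_mono hμ hd.const (hd.comp_squash hS i hs).const ?_
        have hae : ∀ᵐ u ∂c.measure μ i, u ∉ gap S x := by
          rw [hgap, GridFace.measure]
          cases c.kind i with
          | full =>
            rw [FaceKind.measure]
            exact (ae_restrict_mem measurableSet_Ico).mono fun u hu =>
              not_le.2 (hu.2.trans (hl c hc i).2.2)
          | lower =>
            rw [FaceKind.measure, ae_dirac_eq]
            exact not_le.2 (hl c hc i).2.1
          | upper =>
            rw [FaceKind.measure, ae_dirac_eq]
            exact not_le.2 (hl c hc i).2.2
        exact (c.ae_of_ae hμ i hae).mono fun q hq => le_comp_squash hd hs fun h => absurd h hq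
    · have hs : S'.max' ⟨x, hS hx⟩ ∈ gap S x := by
        rw [hgap]
        exact S'.le_max' x (hS hx)
      have hle : ∀ q, d q ≤ (d ∘ squash i (gap S x) (S'.max' ⟨x, hS hx⟩)) q := by
        intro q
        by_cases hq : q i ∈ gap S x → q i ≤ S'.max' ⟨x, hS hx⟩
        · exact le_comp_squash hd hs hq
        · push Not at hq
          refine (hd.const _ _ fun j s hs' => ?_).le
          unfold squash
          split_ifs with hj
          · rw [hj.1]
            exact ⟨fun _ => S'.le_max' s hs', fun _ => (S'.le_max' s hs').trans hq.2.le⟩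
          · rfl
      refine ⟨_, hs, hmono _ hs (fun q => ?_) fun c hc => ?_⟩
      · by_cases hq : q i ∈ gap S x
        · exact mul_le_mul_of_nonneg_left (hle q) (hsign q i (hgap.subset hq))
        · rw [Function.comp_apply, squash_of_notMem hq]
      · exact c.avg_mono hμ hd.const (hd.comp_squash hS i hs).const (Eventually.of_forall hle)

end Squashing

/-! ### Harder-Narasimhan filtrations along the stability conditions of the family -/

section DimensionVectors

variable {K : Type u} [Field K] {n : ℕ} {T : Type} [LinearOrder T] {S : Finset T}

/-- The dimension vector of a finitely presentable submodule. -/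
theorem PersSub.exists_isDimLike {V : Pers K (Fin n → T)} (hV : HNPersistence.IsGridded S V)
    {A : PersSub V} (hA : IsFP A.toPers) :
    ∃ S', S ⊆ S' ∧ IsDimLike S S' fun q => (dimVec A.toPers q : ℝ) := by
  classical
  obtain ⟨S₂, -, hS₂⟩ := (PersSub.isFP_toPers_iff (isFP_iff_exists_isGridded.2 ⟨S, hV⟩)).1 hA
  have hA' := (PersSub.isGridded_toPers_iff (hV.mono (Finset.subset_union_left (s₂ := S₂)))).2
    (hS₂.mono Finset.subset_union_right)
  refine ⟨S ∪ S₂, Finset.subset_union_left, ⟨fun p q hpq => ?_, fun p q hpq hc => ?_,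
    fun q hq => ?_⟩⟩
  · have key : ∀ r q, SameCell (S ∪ S₂) r q → r ≤ q → dimVec A.toPers r = dimVec A.toPers q :=
      fun r q hr hle =>
        (LinearEquiv.ofBijective _ (hA'.bijective r q (homOfLE hle) hr)).finrank_eq
    rw [← key _ p (hpq.inf.trans hpq.symm) inf_le_left, key _ q hpq.inf inf_le_right]
  · have := hV.finite q
    have hinj := (hV.bijective p q (homOfLE hpq) hc).1
    refine Nat.cast_le.2 ((Submodule.equivMapOfInjective _ hinj
      (A.space p)).finrank_eq.le.trans (Submodule.finrank_mono ?_))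
    rintro _ ⟨x, hx, rfl⟩
    exact A.map_le _ hx
  · have := hV.subsingleton q hq
    have : Subsingleton (A.toPers.obj q) := inferInstanceAs (Subsingleton (A.space q))
    exact Nat.cast_eq_zero.2 Module.finrank_zero_of_subsingleton

end DimensionVectors

section Family

variable {K : Type u} [Field K] {n : ℕ} {T : Type} [LinearOrder T] [MeasurableSpace T]
  {μ : Measure T} {Z : StabilityCondition K (Fin n → T)} {S : Finset T}

theorem MemFamily.isDimInvariant (hZ : MemFamily μ Z) : Z.IsDimInvariant := by
  obtain ⟨G, -, G', a, b, l, -, -, -, -, -, -, -, hval⟩ := hZ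
  intro V W hV hW hVW
  rw [hval V hV, hval W hW, hVW]

variable [TopologicalSpace T] [OrderClosedTopology T] [OpensMeasurableSpace T]

theorem measurableSet_aboveGrid (S : Finset T) : MeasurableSet (aboveGrid (n := n) S) := by
  have h : aboveGrid (n := n) S = ⋂ i, ⋃ s ∈ S, {q | s ≤ q i} := by
    ext q
    simp [aboveGrid]
  rw [h]
  exact MeasurableSet.iInter fun i => Finset.measurableSet_biUnion _ fun s _ =>
    measurableSet_Ici.preimage (measurable_pi_apply i)

/-- The density `a` is integrable above the grid: there it has bounded support and is constant on
the cells. -/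
theorem integrable_indicator_aboveGrid [SigmaFinite μ] (hμ : ∀ x y, μ (Set.Ico x y) ≠ ∞)
    {m M : T} (hM : M ∈ S) (hmS : ∀ s ∈ S, m ≤ s) {a : (Fin n → T) → ℝ}
    (ha : ∀ p q : Fin n → T, (∀ i, m ≤ p i ∧ p i < M ∧ ∀ s ∈ S, s ≤ p i ↔ s ≤ q i) → a p = a q)
    (ha0 : ∀ q i, M ≤ q i → a q = 0) :
    Integrable ((aboveGrid S).indicator a) (Measure.pi fun _ => μ) := by
  have hconst : IsCellConst S ((aboveGrid S).indicator a) := by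
    intro p q hpq
    by_cases hp : p ∈ aboveGrid S
    · rw [Set.indicator_of_mem hp, Set.indicator_of_mem (hpq.mem_aboveGrid_iff.1 hp)]
      by_cases hpM : ∃ i, M ≤ p i
      · obtain ⟨i, hi⟩ := hpM
        rw [ha0 p i hi, ha0 q i ((hpq i M hM).1 hi)]
      · push Not at hpM
        refine ha p q fun i => ⟨?_, hpM i, hpq i⟩
        obtain ⟨s, hs, hsp⟩ := hp i
        exact (hmS s hs).trans hsp
    · rw [Set.indicator_of_notMem hp,
        Set.indicator_of_notMem fun hq => hp (hpq.mem_aboveGrid_iff.2 hq)]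
  obtain ⟨B, hB⟩ := hconst.exists_bound
  have hbox : IntegrableOn ((aboveGrid S).indicator a) (Set.univ.pi fun _ => Set.Ico m M)
      (Measure.pi fun _ => μ) := by
    refine Measure.integrableOn_of_bounded ?_ hconst.measurable.aestronglyMeasurable
      (Eventually.of_forall hB)
    rw [Measure.pi_pi]
    exact ENNReal.prod_ne_top fun i _ => hμ m M
  refine hbox.integrable_of_forall_notMem_eq_zero fun q hq => ?_
  by_cases hqS : q ∈ aboveGrid S
  · rw [Set.indicator_of_mem hqS]
    by_contra hne
    refine hq fun i _ => ?_
    obtain ⟨s, hs, hsq⟩ := hqS i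
    exact ⟨(hmS s hs).trans hsq, lt_of_not_ge fun h => hne (ha0 q i h)⟩
  · exact Set.indicator_of_notMem hqS _

/-- The level of a submodule, in terms of its dimension vector. Cutting the densities off outside
of the points above the grid changes nothing, as dimension vectors vanish there, and makes the
first one integrable. -/
theorem level_eq_integral_add_sum {S' : Finset T} {G : GridFunction n T} {l : GridFace G →₀ ℝ≥0}
    {a b : (Fin n → T) → ℝ} {V : Pers K (Fin n → T)} {A : PersSub V}
    (hval : Z.val A.toPers =
      (∫ q, ((b q : ℂ) + Complex.I * (a q : ℂ)) * (dimVec A.toPers q : ℂ)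
        ∂(Measure.pi fun _ => μ)) + Complex.I *
          ((l.sum fun c t => (t : ℝ) * c.avg μ fun q => (dimVec A.toPers q : ℝ) : ℝ) : ℂ))
    (hd : IsDimLike S S' fun q => (dimVec A.toPers q : ℝ))
    (ha : Integrable ((aboveGrid S).indicator a) (Measure.pi fun _ => μ))
    (hb : Integrable ((aboveGrid S).indicator b) (Measure.pi fun _ => μ)) (θ : ℝ) :
    level Z θ A = (∫ q, (aboveGrid S).indicator (fun q => a q - θ * b q) q *
      (dimVec A.toPers q : ℝ) ∂(Measure.pi fun _ => μ)) +
        ∑ c ∈ l.support, l c * c.avg μ fun q => (dimVec A.toPers q : ℝ) := by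
  obtain ⟨B, hB⟩ := hd.const.exists_bound
  have hmul : ∀ {f : (Fin n → T) → ℝ}, Integrable f (Measure.pi fun _ => μ) →
      Integrable (fun q => f q * (dimVec A.toPers q : ℝ)) (Measure.pi fun _ => μ) := fun hf =>
    hf.mul_bdd hd.const.measurable.aestronglyMeasurable (Eventually.of_forall hB)
  have hI : ∫ q, ((b q : ℂ) + Complex.I * (a q : ℂ)) * (dimVec A.toPers q : ℂ)
        ∂(Measure.pi fun _ => μ) =
      ((∫ q, (aboveGrid S).indicator b q * (dimVec A.toPers q : ℝ)
          ∂(Measure.pi fun _ => μ) : ℝ) : ℂ) +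
        Complex.I * ((∫ q, (aboveGrid S).indicator a q * (dimVec A.toPers q : ℝ)
          ∂(Measure.pi fun _ => μ) : ℝ) : ℂ) := by
    rw [← integral_complex_ofReal, ← integral_complex_ofReal, ← integral_const_mul,
      ← integral_add (hmul hb).ofReal ((hmul ha).ofReal.const_mul _)]
    refine integral_congr_ae (Eventually.of_forall fun q => ?_)
    by_cases hq : q ∈ aboveGrid S
    · simp only [Set.indicator_of_mem hq]
      push_cast
      ring
    · have h0 : dimVec A.toPers q = 0 := Nat.cast_eq_zero.1 (hd.zero q (by
        simpa [aboveGrid] using hq))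
      simp only [h0]
      push_cast
      ring
  have hsum : (l.sum fun c t => (t : ℝ) * c.avg μ fun q => (dimVec A.toPers q : ℝ)) =
    ∑ c ∈ l.support, l c * c.avg μ fun q => (dimVec A.toPers q : ℝ) := rfl
  have hsplit : ∫ q, (aboveGrid S).indicator (fun q => a q - θ * b q) q *
        (dimVec A.toPers q : ℝ) ∂(Measure.pi fun _ => μ) =
      (∫ q, (aboveGrid S).indicator a q * (dimVec A.toPers q : ℝ) ∂(Measure.pi fun _ => μ)) -
        θ * ∫ q, (aboveGrid S).indicator b q * (dimVec A.toPers q : ℝ)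
          ∂(Measure.pi fun _ => μ) := by
    rw [← integral_const_mul, ← integral_sub (hmul ha) ((hmul hb).const_mul θ)]
    refine integral_congr_ae (Eventually.of_forall fun q => ?_)
    by_cases hq : q ∈ aboveGrid S
    · simp only [Set.indicator_of_mem hq]
      ring
    · simp only [Set.indicator_of_notMem hq]
      ring
  rw [level, hval, hI]
  simp only [Complex.add_re, Complex.add_im, Complex.mul_re, Complex.mul_im, Complex.ofReal_re,
    Complex.ofReal_im, Complex.I_re, Complex.I_im]
  rw [hsum, hsplit]
  ring

/-- Every finitely presentable module has a finite grid to which all of its finitely presentable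
submodules can be discretised. -/
theorem MemFamily.exists_isDiscretisable [NoMaxOrder T] [NoMinOrder T] [Nonempty T]
    [SigmaFinite μ] (hμ : ∀ x y, μ (Set.Ico x y) ≠ ∞)
    (hμ0 : ∀ x y, x < y → μ (Set.Ico x y) ≠ 0) (hZ : MemFamily μ Z) {V : Pers K (Fin n → T)}
    (hV : IsFP V) : ∃ S, IsGridded S V ∧ IsDiscretisable Z V S := by
  classical
  obtain ⟨G, hG, G', a, b, l, -, hGa, hGb, ha0, ha0', hbpos, hbint, hval⟩ := hZ
  obtain ⟨S₁, hS₁⟩ := isFP_iff_exists_isGridded.1 hV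
  let Sl : Finset T := l.support.biUnion fun c =>
    Finset.univ.biUnion fun i => {G.toFun c.base i, c.corner i}
  have hSl : ∀ c ∈ l.support, ∀ i, G.toFun c.base i ∈ Sl ∧ c.corner i ∈ Sl := fun c hc i =>
    ⟨Finset.mem_biUnion.2 ⟨c, hc, Finset.mem_biUnion.2 ⟨i, Finset.mem_univ _, by simp⟩⟩,
      Finset.mem_biUnion.2 ⟨c, hc, Finset.mem_biUnion.2 ⟨i, Finset.mem_univ _, by simp⟩⟩⟩
  obtain ⟨S, m, M, hSS, hmS, hMS, hmM, hM, hab, haM⟩ :=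
    exists_adapted_grid hGa hGb ha0 ha0' (S₁ ∪ Sl)
  have hVS := hS₁.mono (Finset.subset_union_left.trans hSS)
  refine ⟨S, hVS, fun θ W U hW hU hUW => ?_⟩
  let h : (Fin n → T) → ℝ := (aboveGrid S).indicator fun q => a q - θ * b q
  have hSm := measurableSet_aboveGrid (n := n) S
  have haint : Integrable ((aboveGrid S).indicator a) (Measure.pi fun _ => μ) :=
    integrable_indicator_aboveGrid hμ hMS (fun s hs => (hmM s hs).1)
      (fun p q hpq => (hab p q fun i => Or.inr (hpq i)).1) haM
  have hbint' : Integrable ((aboveGrid S).indicator b) (Measure.pi fun _ => μ) :=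
    hbint.indicator hSm
  have hh : ∀ q, h q = (aboveGrid S).indicator a q - θ * (aboveGrid S).indicator b q := by
    intro q
    by_cases hq : q ∈ aboveGrid S
    · simp only [h, Set.indicator_of_mem hq]
    · simp only [h, Set.indicator_of_notMem hq, mul_zero, sub_zero]
  have hhint : Integrable h (Measure.pi fun _ => μ) := by
    refine (haint.sub (hbint'.const_mul θ)).congr (Eventually.of_forall fun q => ?_)
    exact (hh q).symm
  have hlevel : ∀ A : PersSub V, IsFP A.toPers → level Z θ A =
      (∫ q, h q * (dimVec A.toPers q : ℝ) ∂(Measure.pi fun _ => μ)) +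
        ∑ c ∈ l.support, l c * c.avg μ fun q => (dimVec A.toPers q : ℝ) := fun A hA => by
    obtain ⟨S', -, hd⟩ := PersSub.exists_isDimLike hVS hA
    exact level_eq_integral_add_sum (hval _ hA) hd haint hbint' θ
  obtain ⟨S', hS', hd⟩ := PersSub.exists_isDimLike hVS hW
  obtain ⟨t, ht, htS, htc, hle⟩ := exists_squash_all hS' hd
    (fun d => (∫ q, h q * d q ∂(Measure.pi fun _ => μ)) + ∑ c ∈ l.support, l c * c.avg μ d)
    fun d hd i x hx => by
      refine exists_squash_le hμ hμ0 hS' hMS (fun s hs => (hmM s hs).2) hhint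
        (fun i x hx hxM q u hu v hv => ?_) ?_ l
        (fun c hc j => ⟨⟨hSS (Finset.mem_union_right _ (hSl c hc j).1),
          hSS (Finset.mem_union_right _ (hSl c hc j).2)⟩,
          hM _ (Finset.mem_union_right _ (hSl c hc j).1),
          hM _ (Finset.mem_union_right _ (hSl c hc j).2)⟩) hd i hx
      · have hcell : ∀ j, ∀ s ∈ S, s ≤ Function.update q i u j ↔ s ≤ Function.update q i v j := by
          intro j s hs
          by_cases hj : j = i
          · subst hj
            rw [Function.update_self, Function.update_self, hu s hs, hv s hs]
          · rw [Function.update_of_ne hj, Function.update_of_ne hj]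
        have := hab (Function.update q i u) (Function.update q i v) fun j => by
          by_cases hj : j = i
          · right
            refine ⟨?_, ?_, hcell j⟩
            · rw [hj, Function.update_self]
              exact (hu m hmS).2 (hmM x hx).1
            · rw [hj, Function.update_self]
              exact lt_of_not_ge fun hMu => absurd ((hu M hMS).1 hMu) (not_le.2 hxM)
          · left
            rw [Function.update_of_ne hj, Function.update_of_ne hj]
        have hmem : Function.update q i u ∈ aboveGrid S ↔ Function.update q i v ∈ aboveGrid S :=
          SameCell.mem_aboveGrid_iff hcell
        by_cases hq : Function.update q i u ∈ aboveGrid S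
        · simp only [h]
          rw [Set.indicator_of_mem hq, Set.indicator_of_mem (hmem.1 hq), this.1, this.2]
        · simp only [h]
          rw [Set.indicator_of_notMem hq, Set.indicator_of_notMem fun hq' => hq (hmem.2 hq')]
      · have hbpos' : ∀ q, 0 ≤ (aboveGrid S).indicator b q :=
          fun q => Set.indicator_nonneg (fun q _ => (hbpos q).le) q
        have hh' : ∀ q i, M ≤ q i → h q = - θ * (aboveGrid S).indicator b q := fun q i hq => by
          rw [hh, Set.indicator_apply_eq_zero.2 fun _ => haM q i hq]
          ring
        rcases le_total 0 θ with hθ | hθ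
        · left
          intro q i hq
          rw [hh' q i hq, neg_mul]
          exact neg_nonpos.2 (mul_nonneg hθ (hbpos' q))
        · right
          intro q i hq
          rw [hh' q i hq]
          exact mul_nonneg (neg_nonneg.2 hθ) (hbpos' q)
  have hψ : Monotone fun (q : Fin n → T) i => t i (q i) := fun p q hpq i => ht i (hpq i)
  have hc : ∀ q : Fin n → T, SameCell S (fun i => t i (q i)) q := fun q i s hs => htS i _ s hs
  have hgrid : (W.pullback hψ).IsGridded S := by
    refine PersSub.isGridded_pullback hψ hVS hc fun p q hpq hq => funext fun i => ?_
    obtain ⟨r, hr, hrc⟩ := exists_floor S q hq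
    exact htc i (r i) (r i).2 _ (fun s hs => (hpq i s hs).trans (hrc i s hs).symm) _
      fun s hs => (hrc i s hs).symm
  refine ⟨W.pullback hψ, hgrid, PersSub.le_pullback hψ hc hU hUW, ?_⟩
  rw [hlevel W hW, hlevel _ ((PersSub.isFP_toPers_iff hV).2 ⟨S, hVS, hgrid⟩)]
  refine hle.trans (le_of_eq ?_)
  have hdv : ∀ q, dimVec (W.pullback hψ).toPers q = dimVec W.toPers fun i => t i (q i) :=
    fun q => PersSub.finrank_pullback hψ hVS hc q
  simp only [hdv]

/-- Existence and uniqueness of Harder-Narasimhan filtrations, and stability of the filtered rank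
invariant, over `T ^ n` for a suitable measured line `T`. -/
theorem MemFamily.existsUnique_and_stable [AddCommGroup T] [IsOrderedAddMonoid T] [ENorm T]
    [NoMaxOrder T] [NoMinOrder T] [SigmaFinite μ] (hμ : ∀ x y, μ (Set.Ico x y) ≠ ∞)
    (hμ0 : ∀ x y, x < y → μ (Set.Ico x y) ≠ 0) (hZ : MemFamily μ Z) :
    (∀ U : Pers K (Fin n → T), IsFP U → ∃! F : LTSeries (PersSub U), IsHNFiltration Z U F) ∧
    ∀ V W : Pers K (Fin n → T), IsFP V → IsFP W →
      (∀ θ : ℝ, IsFunctorial (hnRank Z V θ) ∧ IsFunctorial (hnRank Z W θ)) ∧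
      (⨆ θ : ℝ, erosionDist (hnRank Z V θ) (hnRank Z W θ)) ≤ interleavingDist V W := by
  have hdim := hZ.isDimInvariant
  have hE : ∀ U : Pers K (Fin n → T), IsFP U → ∃ F, IsHNFiltration Z U F := fun U hU => by
    obtain ⟨S, hS, hd⟩ := hZ.exists_isDiscretisable hμ hμ0 hU
    exact exists_isHNFiltration hdim hS hd
  refine ⟨fun U hU => ?_, fun V W hV hW => ⟨fun θ => ⟨?_, ?_⟩, ?_⟩⟩
  · obtain ⟨F, hF⟩ := hE U hU
    exact ⟨F, hF, fun F' hF' => hF'.unique hdim hU hF⟩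
  · exact isFunctorial_of_mono fun hx hy => hnRank_mono hdim hE hV θ hx hy
  · exact isFunctorial_of_mono fun hx hy => hnRank_mono hdim hE hW θ hx hy
  · exact iSup_le fun θ => erosionDist_hnRank_le hdim hE hV hW θ

end Family

end HNPersistence

end

open HNPersistence in
theorem theoremB {K : Type*} [Field K] (n : ℕ) :
    (∀ Z : StabilityCondition K (Fin n → ℝ), MemFamily MeasureTheory.volume Z →
      (∀ U : Pers K (Fin n → ℝ), IsFP U →
        ∃! F : LTSeries (PersSub U), IsHNFiltration Z U F) ∧
      ∀ V W : Pers K (Fin n → ℝ), IsFP V → IsFP W →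
        (∀ θ : ℝ, IsFunctorial (hnRank Z V θ) ∧ IsFunctorial (hnRank Z W θ)) ∧
        (⨆ θ : ℝ, erosionDist (hnRank Z V θ) (hnRank Z W θ)) ≤ interleavingDist V W) ∧
    (∀ Z : StabilityCondition K (Fin n → ℤ), MemFamily MeasureTheory.Measure.count Z →
      (∀ U : Pers K (Fin n → ℤ), IsFP U →
        ∃! F : LTSeries (PersSub U), IsHNFiltration Z U F) ∧
      ∀ V W : Pers K (Fin n → ℤ), IsFP V → IsFP W →
        (∀ θ : ℝ, IsFunctorial (hnRank Z V θ) ∧ IsFunctorial (hnRank Z W θ)) ∧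
        (⨆ θ : ℝ, erosionDist (hnRank Z V θ) (hnRank Z W θ)) ≤ interleavingDist V W) := by
  refine ⟨fun Z hZ => hZ.existsUnique_and_stable (fun x y => ?_) fun x y hxy => ?_,
    fun Z hZ => hZ.existsUnique_and_stable (fun x y => ?_) fun x y hxy => ?_⟩
  · rw [Real.volume_Ico]
    exact ENNReal.ofReal_ne_top
  · rw [Real.volume_Ico]
    exact (ENNReal.ofReal_pos.2 (sub_pos.2 hxy)).ne'
  · exact (Measure.count_apply_lt_top.2 (Set.finite_Ico x y)).ne
  · rw [Measure.count_ne_zero_iff]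
    exact ⟨x, le_rfl, hxy⟩
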